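/- Let $\kappa$ be the security parameter and let $k=k(\kappa)$, $m=m(\kappa)$ and the bit length of a modulus $N=N(\kappa)\ge 1$ be polynomially bounded in $\kappa$. Party $P_0$ holds a dense matrix $X\in\mathbb{Z}_N^{k\times m}$ and party $P_1$ holds a sparse matrix $Y\in\mathbb{Z}_N^{m\times m}$; a set $l=l(\kappa)\subseteq[m]\times[m]$ of positions that contains the positions of all nonzero entries of $Y$ is public (insensitive sparsity). A value $x\in\mathbb{Z}_N$ is shared additively, $x=[\![x]\!]_0+[\![x]\!]_1$, where $P_b$ holds $[\![x]\!]_b$. Let $\mathsf{Add}$ and $\mathsf{Mul}$ be (families of) two-party protocols that take shares of $x$ and of $y$ and give the parties shares of $x+y$ and of $xy$, respectively. The protocol $\mathsf{MatrixMul}(X,Y)$ is the following. For each $i\in[k]$ and $j\in[m]$ both parties set their shares of $z_{i,j}$ to $0$; then, for each $a$ with $(a,j)\in l$, one after the other, $P_0$ shares $x_{i,a}$ and $P_1$ shares $y_{a,j}$ (each keeps its value minus a fresh uniformly random element of $\mathbb{Z}_N$ and sends this random element to the other party), and the parties set $[\![z_{i,j}]\!]\gets\mathsf{Add}(\mathsf{Mul}([\![x_{i,a}]\!],[\![y_{a,j}]\!]),[\![z_{i,j}]\!])$.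 The output is the shares of $Z=(z_{i,j})$. A protocol that gives the parties additive shares of $f(\text{inputs})$ is called secure against semi-honest adversaries if for each $b\in\{0,1\}$ there is a simulator of size polynomial in $\kappa$ which, from the input of $P_b$ and its own random coins only, outputs a simulated list of the random values given to $P_b$ and of the messages received by $P_b$, together with a share $o$, such that for all admissible inputs (chosen for each $\kappa$) no polynomial-size family of Boolean circuits distinguishes with non-negligible advantage between - the input of $P_b$, its random values and received messages, its output share and the output share of $P_{1-b}$ in a real execution, and - the input of $P_b$, the simulated list, the simulated share $o$, and $f(\text{inputs})-o$. (In a protocol, random values may be private coins or input-independent correlated randomness from an offline phase, such as Beaver's triples. Simulators are Boolean circuits whose coins are independent uniform samples from finite ranges.) Claim: if $\mathsf{Add}$ and $\mathsf{Mul}$ are secure against semi-honest adversaries for the functions $x+y$ and $xy$ on all shares of $x,y\in\mathbb{Z}_N$, then $\mathsf{MatrixMul}$ is secure against semi-honest adversaries for the function $(X,Y)\mapsto XY$ on all $X$ and all $Y$ whose nonzero entries are at positions in $l$. -/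

import Mathlib

open scoped Matrix

noncomputable section

namespace SparseMPC

/-! ### Binary encodings -/

/-- A fixed-length injective binary encoding of a type. -/
class BitCode (α : Type) where
  len : ℕ
  enc : α → List Bool
  length_enc : ∀ a, (enc a).length = len
  enc_injective : Function.Injective enc

/-- The `w` least significant bits of `n`, least significant bit first. -/
def natBits (w n : ℕ) : List Bool := (List.range w).map n.testBit

/-- Residues modulo `N` are written in binary, with as many digits as `N` has. -/
instance instBitCodeZMod (N : ℕ) [NeZero N] : BitCode (ZMod N) where
  len := N.size
  enc z := natBits N.size z.val
  length_enc z := by simp [natBits]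
  enc_injective := by
    intro x y h
    apply ZMod.val_injective N
    have hx : x.val < 2 ^ N.size := (ZMod.val_lt x).trans (Nat.lt_size_self N)
    have hy : y.val < 2 ^ N.size := (ZMod.val_lt y).trans (Nat.lt_size_self N)
    apply Nat.eq_of_testBit_eq
    intro i
    by_cases hi : i < N.size
    · simp only [natBits, List.map_inj_left, List.mem_range] at h
      exact h i hi
    · have hp : 2 ^ N.size ≤ 2 ^ i := Nat.pow_le_pow_right (by norm_num) (by omega)
      rw [Nat.testBit_lt_two_pow (hx.trans_le hp), Nat.testBit_lt_two_pow (hy.trans_le hp)]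

/-- A pair is encoded by concatenation. -/
instance instBitCodeProd (α β : Type) [BitCode α] [BitCode β] : BitCode (α × β) where
  len := BitCode.len α + BitCode.len β
  enc p := BitCode.enc p.1 ++ BitCode.enc p.2
  length_enc p := by simp [BitCode.length_enc]
  enc_injective := by
    rintro ⟨a, b⟩ ⟨a', b'⟩ h
    obtain ⟨h₁, h₂⟩ := List.append_inj h (by simp [BitCode.length_enc])
    exact Prod.ext (BitCode.enc_injective h₁) (BitCode.enc_injective h₂)

/-- A vector is encoded by concatenation. -/
instance instBitCodePi (n : ℕ) (α : Type) [BitCode α] : BitCode (Fin n → α) where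
  len := n * BitCode.len α
  enc f := (List.ofFn fun i => BitCode.enc (f i)).flatten
  length_enc f := by
    simp [List.length_flatten, List.map_ofFn, Function.comp_def, BitCode.length_enc]
  enc_injective := by
    intro f g h
    have h' := List.eq_iff_flatten_eq.2 ⟨h, by
      simp [List.map_ofFn, Function.comp_def, BitCode.length_enc]⟩
    funext i
    exact BitCode.enc_injective (congrFun (List.ofFn_injective h') i)

/-- A matrix is encoded row by row. -/
instance instBitCodeMatrix (a b : ℕ) (α : Type) [BitCode α] :
    BitCode (Matrix (Fin a) (Fin b) α) :=
  inferInstanceAs (BitCode (Fin a → Fin b → α))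

/-! ### Boolean circuits -/

/-- `StraightLine L`: the list `L` (latest gate first) consists of the Boolean functions computed
at the gates of a Boolean circuit whose gates are input wires, constants and NAND gates.
The input is a bit string; wires beyond its end carry `false`. -/
inductive StraightLine : List (List Bool → Bool) → Prop
  | nil : StraightLine []
  | input (L : List (List Bool → Bool)) (i : ℕ) :
      StraightLine L → StraightLine ((fun v => v.getD i false) :: L)
  | const (L : List (List Bool → Bool)) (c : Bool) :
      StraightLine L → StraightLine ((fun _ => c) :: L)
  | nand (L : List (List Bool → Bool)) (g h : List Bool → Bool) :
      StraightLine L → g ∈ L → h ∈ L → StraightLine ((fun v => !(g v && h v)) :: L)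

/-- `F` is computed by a Boolean circuit with several output wires, where the number of gates plus
the number of output wires is at most `s`. -/
def HasCircuit (s : ℕ) (F : List Bool → List Bool) : Prop :=
  ∃ L outs : List (List Bool → Bool), StraightLine L ∧ (∀ g ∈ outs, g ∈ L) ∧
    L.length + outs.length ≤ s ∧ ∀ v, F v = outs.map fun g => g v

/-- Polynomially bounded functions of the security parameter. -/
def PolyBounded (s : ℕ → ℕ) : Prop := ∃ p : Polynomial ℕ, ∀ κ, s κ ≤ p.eval κ

/-- Negligible functions of the security parameter. -/
def Negligible (ε : ℕ → ℝ) : Prop :=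
  Asymptotics.SuperpolynomialDecay Filter.atTop (fun κ : ℕ => (κ : ℝ)) ε

/-! ### Two-party protocols

The parties `P₀` and `P₁` are indexed by `false` and `true`; the other party of `b` is `!b`. -/

/-- A two-party protocol that takes private local states of types `S false`, `S true` to private
local states of types `T false`, `T true`. -/
inductive Protocol : (Bool → Type) → (Bool → Type) → Type 1
  /-- Each party computes locally on its own state. -/
  | compute {S T : Bool → Type} (f : ∀ b, S b → T b) : Protocol S T
  /-- Input-independent randomness: party `b` receives the component `b` of a sample of `d`.
  A product distribution describes private coins of the two parties, any other distribution
  describes correlated randomness prepared in an offline phase (such as a Beaver triple). -/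
  | deal {S : Bool → Type} (B : Bool → Type) [∀ b, BitCode (B b)] (d : PMF (∀ b, B b)) :
      Protocol S (fun b => S b × B b)
  /-- Each party sends a message, computed from its own state, to the other party. -/
  | exchange {S : Bool → Type} (B : Bool → Type) [∀ b, BitCode (B b)] (msg : ∀ b, S b → B b) :
      Protocol S (fun b => S b × B (!b))
  /-- Sequential composition. -/
  | seq {S T U : Bool → Type} : Protocol S T → Protocol T U → Protocol S U
  /-- Each party sets a part of its state aside while a subprotocol runs on the other part. -/
  | frame {S T : Bool → Type} (R : Bool → Type) :
      Protocol S T → Protocol (fun b => S b × R b) (fun b => T b × R b)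

namespace Protocol

/-- The joint distribution of the final states and of the two transcripts. The transcript of a
party lists, in order, all the randomness that it is given and all the messages that it receives;
so the input and the transcript of a party form its view. -/
def run : {S T : Bool → Type} → Protocol S T → (∀ b, S b) →
    PMF ((∀ b, T b) × (Bool → List Bool))
  | _, _, compute f, s => PMF.pure (fun b => f b (s b), fun _ => [])
  | _, _, deal _ d, s => d.map fun r => (fun b => (s b, r b), fun b => BitCode.enc (r b))
  | _, _, exchange _ msg, s =>
      PMF.pure (fun b => (s b, msg (!b) (s (!b))), fun b => BitCode.enc (msg (!b) (s (!b))))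
  | _, _, seq p q, s =>
      (run p s).bind fun r => (run q r.1).map fun r' => (r'.1, fun b => r.2 b ++ r'.2 b)
  | _, _, frame _ p, s =>
      (run p fun b => (s b).1).map fun r => (fun b => (r.1 b, (s b).2), r.2)

/-- The length of the transcript of party `b`. -/
def transcriptLen : {S T : Bool → Type} → Protocol S T → Bool → ℕ
  | _, _, compute _, _ => 0
  | _, _, deal B _, b => BitCode.len (B b)
  | _, _, exchange B _, b => BitCode.len (B (!b))
  | _, _, seq p q, b => transcriptLen p b + transcriptLen q b
  | _, _, frame _ p, b => transcriptLen p b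

/-- Run the protocols `p i`, for `i` in a list, one after the other. -/
def forEach {ι : Type} {S : Bool → Type} (p : ι → Protocol S S) : List ι → Protocol S S
  | [] => compute fun _ s => s
  | i :: L => seq (p i) (forEach p L)

end Protocol

/-! ### Security against semi-honest adversaries

The protocols considered here give each party an additive share of the result: the result is the
sum of the two outputs. -/

section Security

variable {A : Bool → Type} [∀ b, BitCode (A b)] {G : Type} [BitCode G]

/-- The real experiment for a corrupted party `b`: the view of this party (input and transcript),
its output share and the output share of the honest party. -/
def real (π : Protocol A (fun _ => G)) (x : ∀ b, A b) (b : Bool) : PMF (List Bool) :=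
  (π.run x).map fun r =>
    BitCode.enc (x b) ++ r.2 b ++ BitCode.enc (r.1 b) ++ BitCode.enc (r.1 (!b))

/-- The random tape of a simulator: independent uniform samples of `{0, …, n}`, for `n` in the given
list, in binary (an entry `n = 1` is a fair coin). -/
def coins : List ℕ → PMF (List Bool)
  | [] => PMF.pure []
  | n :: μ => (PMF.uniformOfFintype (Fin (n + 1))).bind fun r =>
      (coins μ).map fun c => natBits n.size r.val ++ c

/-- The ideal experiment for a corrupted party `b`, where `y` is the prescribed result. The simulator
sees the input of party `b` and its own random tape and produces a transcript and an output share
of party `b`; the functionality gives the honest party the share that completes this one to `y`. -/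
def ideal [Sub G] (b : Bool) (μ : List ℕ) (sim : A b → List Bool → List Bool × G)
    (x : ∀ b, A b) (y : G) : PMF (List Bool) :=
  (coins μ).map fun c =>
    BitCode.enc (x b) ++ (sim (x b) c).1 ++ BitCode.enc (sim (x b) c).2 ++
      BitCode.enc (y - (sim (x b) c).2)

/-- The advantage of the distinguisher `D` between two distributions of bit strings. -/
def advantage (D : List Bool → Bool) (P Q : PMF (List Bool)) : ℝ :=
  |((P.map D) true).toReal - ((Q.map D) true).toReal|

end Security

/-- The family `π` of protocols, indexed by the security parameter `κ`, is secure against semi-honest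
adversaries for the functionality that hands out additive shares of `f κ x` for `x ∈ dom κ`:
for each corrupted party there is a simulator of polynomial size such that no distinguisher of
polynomial size can tell the real from the ideal experiment with non-negligible advantage, on
whatever inputs. -/
def SemiHonestSecure {A : ℕ → Bool → Type} [∀ κ b, BitCode (A κ b)]
    {G : ℕ → Type} [∀ κ, BitCode (G κ)] [∀ κ, Sub (G κ)]
    (π : ∀ κ, Protocol (A κ) (fun _ => G κ))
    (dom : ∀ κ, Set (∀ b, A κ b)) (f : ∀ κ, (∀ b, A κ b) → G κ) : Prop :=
  ∀ b : Bool, ∃ (μ : ℕ → List ℕ) (sim : ∀ κ, A κ b → List Bool → List Bool × G κ),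
    (∀ κ a c, (sim κ a c).1.length = (π κ).transcriptLen b) ∧
    PolyBounded (fun κ => ((μ κ).map Nat.size).sum) ∧
    (∃ s : ℕ → ℕ, PolyBounded s ∧ ∀ κ, ∃ F, HasCircuit (s κ) F ∧
      ∀ a, ∀ c ∈ (coins (μ κ)).support,
        F (BitCode.enc a ++ c) = (sim κ a c).1 ++ BitCode.enc (sim κ a c).2) ∧
    ∀ (D : ℕ → List Bool → Bool) (s : ℕ → ℕ), PolyBounded s →
      (∀ κ, HasCircuit (s κ) fun v => [D κ v]) →
      ∀ x : ∀ κ b, A κ b, (∀ κ, x κ ∈ dom κ) →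
        Negligible fun κ =>
          advantage (D κ) (real (π κ) (x κ) b) (ideal b (μ κ) (sim κ) (x κ) (f κ (x κ)))

/-! ### Addition and multiplication of shared values -/

/-- The input of a party to `Add` or `Mul`: its shares of the two operands. -/
abbrev SharePair (N : ℕ) : Bool → Type := fun _ => ZMod N × ZMod N

/-- The sum of the two shared operands. -/
def sumOfShared {N : ℕ} (s : ∀ b, SharePair N b) : ZMod N :=
  ((s false).1 + (s true).1) + ((s false).2 + (s true).2)

/-- The product of the two shared operands. -/
def prodOfShared {N : ℕ} (s : ∀ b, SharePair N b) : ZMod N :=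
  ((s false).1 + (s true).1) * ((s false).2 + (s true).2)

/-! ### Dense-sparse matrix multiplication with insensitive sparsity -/

/-- `P₀` holds a dense `k × m` matrix `X`, and `P₁` holds a sparse `m × m` matrix `Y`. -/
abbrev MatIn (k m N : ℕ) : Bool → Type
  | false => Matrix (Fin k) (Fin m) (ZMod N)
  | true => Matrix (Fin m) (Fin m) (ZMod N)

instance instBitCodeMatIn (k m N : ℕ) [NeZero N] : ∀ b, BitCode (MatIn k m N b)
  | false => instBitCodeMatrix k m (ZMod N)
  | true => instBitCodeMatrix m m (ZMod N)

section MatrixMul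

variable {k m N : ℕ} [NeZero N]

/-- The rows of the positions of column `j` in the public pattern `l`. The aligned bins for an output
entry `(i, j)` contain the `x i a` and the `y a j` for the `a` in this list. -/
def bin (l : Finset (Fin m × Fin m)) (j : Fin m) : List (Fin m) :=
  (List.finRange m).filter fun a => (a, j) ∈ l

/-- The local state of a party during the protocol: its input and its shares of the output. -/
abbrev MatState (k m N : ℕ) : Bool → Type :=
  fun b => MatIn k m N b × Matrix (Fin k) (Fin m) (ZMod N)

/-- The value that a party has to share for the product `x i a * y a j`. -/
def ownValue (i : Fin k) (j a : Fin m) : (b : Bool) → MatIn k m N b → ZMod N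
  | false, X => X i a
  | true, Y => Y a j

/-- The shares of `x i a` and `y a j` that a party holds, from its own value `v`, its own mask `r`
(the share that it has sent) and the share `r'` that it has received. -/
def sharesHeld (v r r' : ZMod N) : Bool → ZMod N × ZMod N
  | false => (v - r, r')
  | true => (r', v - r)

/-- One pass through the inner loop: both parties share their values by `Shr` (a uniform mask is the
share of the other party), multiply by `Mul` and add the product to `z i j` by `Add`. -/
def innerStep (add mul : Protocol (SharePair N) (fun _ => ZMod N)) (i : Fin k) (j a : Fin m) :
    Protocol (MatState k m N) (MatState k m N) :=
  .seq (.deal (fun _ => ZMod N) (PMF.uniformOfFintype (Bool → ZMod N))) <|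
  .seq (.exchange (fun _ => ZMod N) fun _ s => s.2) <|
  .seq (.compute (T := fun b => SharePair N b × MatState k m N b)
    fun b s => (sharesHeld (ownValue i j a b s.1.1.1) s.1.2 s.2 b, s.1.1)) <|
  .seq (.frame (MatState k m N) mul) <|
  .seq (.compute (T := fun b => SharePair N b × MatState k m N b)
    fun _ s => ((s.1, s.2.2 i j), s.2)) <|
  .seq (.frame (MatState k m N) add) <|
  .compute fun _ s => (s.2.1, s.2.2.updateRow i (Function.update (s.2.2 i) j s.1))

/-- The protocol `MatrixMul(X, Y)` for a public pattern `l` of the positions of the nonzero entries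
of `Y`. -/
def matrixMul (add mul : Protocol (SharePair N) (fun _ => ZMod N)) (l : Finset (Fin m × Fin m)) :
    Protocol (MatIn k m N) (fun _ => Matrix (Fin k) (Fin m) (ZMod N)) :=
  .seq (.compute (T := MatState k m N) fun _ x => (x, 0)) <|
  .seq (.forEach (fun i : Fin k => .forEach (fun j : Fin m =>
    .forEach (fun a => innerStep add mul i j a) (bin l j)) (List.finRange m)) (List.finRange k)) <|
  .compute fun _ s => s.2

/-- The admissible inputs: the nonzero entries of `Y` are at positions in `l`. -/
def supportedIn (l : Finset (Fin m × Fin m)) : Set (∀ b, MatIn k m N b) :=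
  {x | ∀ a j, (a, j) ∉ l → (x true : Matrix (Fin m) (Fin m) (ZMod N)) a j = 0}

/-- The matrix product `X * Y`. -/
def matProd (x : ∀ b, MatIn k m N b) : Matrix (Fin k) (Fin m) (ZMod N) :=
  (x false : Matrix (Fin k) (Fin m) (ZMod N)) * (x true : Matrix (Fin m) (Fin m) (ZMod N))

end MatrixMul

end SparseMPC

end

noncomputable section

namespace SparseMPC

/-! ### A calculus of circuit sizes -/

/-! The proof is a composition theorem obtained by a hybrid argument. The security experiment
contains the output share of the honest party as well as the view of the corrupted party `b`. A
simulator therefore describes the joint final state: if it outputs the share `o`, then the other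
share is `f - o`. This suggests viewing a simulation as a map `I` from both initial states and a
random tape to both final states and the transcript of `b`, where the parts belonging to `b` depend
only on the state of `b` (`IsSimulation`). Such maps compose, although the simulator alone never
sees the other state.

For a sequence of two protocols (`Simulatable.seq`), the second is replaced by its simulation while
the first still runs, with the transcript of the first hardwired into the distinguisher. Then the
first is replaced, with the simulation of the second, at a fixed tape, absorbed into the
distinguisher. Circuit sizes and advantage factors only add up, so polynomially many steps stay
polynomial. This is why `Computes` counts additional gates only: rewiring is free.

The building blocks are local computation and sharing, both simulated exactly
(`Simulatable.compute`, `simulatable_share`), and calls of `Add` and `Mul`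
(`IsSimulator.simulatable_frame`), where the states set aside are hardwired into the distinguisher.
Correctness travels along as an exact relation between initial and final simulated states: each pass
adds one product to the shared matrix, and the products over the pattern sum to `X * Y`
(`sum_summand`).

The asymptotic hypothesis speaks of one sequence of inputs and distinguishers at a time. Since
distinguishers are nonuniform, choosing a nearly optimal pair for each `κ` turns it into a
negligible bound uniform in inputs and circuits of a given size (`exists_negligible_bound`); the
hybrid argument then works at each `κ` separately. -/

/-- The bits `g` can be computed from the bits `f` with at most `s` additional gates. -/
def Computes {Ω : Type} (s : ℕ) (f g : Ω → List Bool) : Prop :=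
  ∀ L ins : List (List Bool → Bool), StraightLine L → (∀ h ∈ ins, h ∈ L) →
    ∃ L' outs : List (List Bool → Bool), StraightLine L' ∧ L ⊆ L' ∧ L'.length ≤ L.length + s ∧
      (∀ h ∈ outs, h ∈ L') ∧
      ∀ v ω, ins.map (fun h => h v) = f ω → outs.map (fun h => h v) = g ω

namespace Computes

variable {Ω Ω' : Type} {s t u : ℕ} {f g h : Ω → List Bool}

theorem mono (H : Computes s f g) (hst : s ≤ t) : Computes t f g := by
  intro L ins hL hins
  obtain ⟨L', outs, h1, h2, h3, h4, h5⟩ := H L ins hL hins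
  exact ⟨L', outs, h1, h2, by omega, h4, h5⟩

theorem congr (H : Computes s f g) (hg : ∀ ω, g ω = h ω) : Computes s f h := by
  rwa [← funext hg]

theorem refl (f : Ω → List Bool) : Computes 0 f f := fun L ins hL hins =>
  ⟨L, ins, hL, fun _ h => h, le_rfl, hins, fun _ _ h => h⟩

theorem reindex (H : Computes s f g) (φ : Ω' → Ω) :
    Computes s (fun ω => f (φ ω)) (fun ω => g (φ ω)) := by
  intro L ins hL hins
  obtain ⟨L', outs, h1, h2, h3, h4, h5⟩ := H L ins hL hins
  exact ⟨L', outs, h1, h2, h3, h4, fun v ω h => h5 v _ h⟩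

theorem trans (H : Computes s f g) (H' : Computes t g h) : Computes (s + t) f h := by
  intro L ins hL hins
  obtain ⟨L', outs, h1, h2, h3, h4, h5⟩ := H L ins hL hins
  obtain ⟨L'', outs', k1, k2, k3, k4, k5⟩ := H' L' outs h1 h4
  exact ⟨L'', outs', k1, List.Subset.trans h2 k2, by omega, k4, fun v ω h => k5 v ω (h5 v ω h)⟩

theorem append (H : Computes s f g) (H' : Computes t f h) :
    Computes (s + t) f (fun ω => g ω ++ h ω) := by
  intro L ins hL hins
  obtain ⟨L', outs, h1, h2, h3, h4, h5⟩ := H L ins hL hins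
  obtain ⟨L'', outs', k1, k2, k3, k4, k5⟩ := H' L' ins h1 fun x hx => h2 (hins x hx)
  refine ⟨L'', outs ++ outs', k1, List.Subset.trans h2 k2, by omega, ?_, fun v ω h => ?_⟩
  · intro x hx
    rcases List.mem_append.1 hx with hx | hx
    · exact k2 (h4 x hx)
    · exact k4 x hx
  · rw [List.map_append, h5 v ω h, k5 v ω h]

theorem take (H : Computes s f g) (n : ℕ) : Computes s f (fun ω => (g ω).take n) := by
  intro L ins hL hins
  obtain ⟨L', outs, h1, h2, h3, h4, h5⟩ := H L ins hL hins
  exact ⟨L', outs.take n, h1, h2, h3, fun x hx => h4 x (List.mem_of_mem_take hx),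
    fun v ω h => by rw [List.map_take, h5 v ω h]⟩

theorem drop (H : Computes s f g) (n : ℕ) : Computes s f (fun ω => (g ω).drop n) := by
  intro L ins hL hins
  obtain ⟨L', outs, h1, h2, h3, h4, h5⟩ := H L ins hL hins
  exact ⟨L', outs.drop n, h1, h2, h3, fun x hx => h4 x (List.mem_of_mem_drop hx),
    fun v ω h => by rw [List.map_drop, h5 v ω h]⟩

theorem left {n : ℕ} (H : Computes s f (fun ω => g ω ++ h ω)) (hn : ∀ ω, (g ω).length = n) :
    Computes s f g :=
  (H.take n).congr fun ω => by rw [List.take_left' (hn ω)]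

theorem right {n : ℕ} (H : Computes s f (fun ω => g ω ++ h ω)) (hn : ∀ ω, (g ω).length = n) :
    Computes s f h :=
  (H.drop n).congr fun ω => by rw [List.drop_left' (hn ω)]

theorem bit (f : Ω → List Bool) (c : Bool) : Computes 1 f (fun _ => [c]) := fun L _ hL _ =>
  ⟨(fun _ => c) :: L, [fun _ => c], .const L c hL, List.subset_cons_self _ _, by simp,
    by simp, by simp⟩

theorem nil (f : Ω → List Bool) : Computes 0 f (fun _ => []) := fun L _ hL _ =>
  ⟨L, [], hL, fun _ h => h, le_rfl, by simp, by simp⟩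

theorem const (f : Ω → List Bool) (l : List Bool) : Computes l.length f (fun _ => l) := by
  induction l with
  | nil => exact nil f
  | cons c l ih => exact ((bit f c).append ih).mono (by simp [add_comm])

theorem nand {a b : Ω → Bool} (ha : Computes s f fun ω => [a ω]) (hb : Computes t f fun ω => [b ω]) :
    Computes (s + t + 1) f fun ω => [!(a ω && b ω)] := by
  intro L ins hL hins
  obtain ⟨L', outs, h1, h2, h3, h4, h5⟩ := (ha.append hb) L ins hL hins
  -- The number of output wires is known only if some input `v` realises a value of `f`. Otherwise
  -- correctness is vacuous and no wire is needed.
  by_cases hl : ∃ p q, outs = [p, q]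
  · obtain ⟨p, q, rfl⟩ := hl
    refine ⟨(fun v => !(p v && q v)) :: L', [fun v => !(p v && q v)],
      .nand L' p q h1 (h4 p (by simp)) (h4 q (by simp)), fun x hx => by simp [h2 hx], ?_, by simp,
      fun v ω h => ?_⟩
    · simp only [List.length_cons]; omega
    · have := h5 v ω h
      simp_all
  · refine ⟨L', [], h1, h2, by omega, by simp, fun v ω h => absurd ?_ hl⟩
    have := congrArg List.length (h5 v ω h)
    simp only [List.length_map, List.singleton_append, List.length_cons, List.length_nil] at this
    exact List.length_eq_two.1 this

theorem not {a : Ω → Bool} (ha : Computes s f fun ω => [a ω]) :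
    Computes (s + s + 1) f fun ω => [!a ω] :=
  (ha.nand ha).congr fun ω => by simp

theorem ite {a b c : Ω → Bool} (ha : Computes s f fun ω => [a ω])
    (hb : Computes t f fun ω => [b ω]) (hc : Computes u f fun ω => [c ω]) :
    Computes (3 * s + t + u + 4) f fun ω => [if a ω then b ω else c ω] :=
  (((ha.nand hb).nand (ha.not.nand hc)).congr fun ω => by cases a ω <;> simp).mono (by omega)

/-- A Boolean function of three bits. -/
theorem bool₃ {a b c : Ω → Bool} (φ : Bool → Bool → Bool → Bool)
    (H : Computes s f fun ω => [a ω, b ω, c ω]) :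
    Computes (s + 36) f fun ω => [φ (a ω) (b ω) (c ω)] := by
  refine H.trans ?_
  have h0 : Computes 0 (fun ω => [a ω, b ω, c ω]) (fun ω => [a ω, b ω, c ω]) := refl _
  have ha : Computes 0 (fun ω => [a ω, b ω, c ω]) (fun ω => [a ω]) := h0.take 1
  have hb : Computes 0 (fun ω => [a ω, b ω, c ω]) (fun ω => [b ω]) := (h0.drop 1).take 1
  have hc : Computes 0 (fun ω => [a ω, b ω, c ω]) (fun ω => [c ω]) := h0.drop 2
  have h3 : ∀ x y, Computes 6 (fun ω => [a ω, b ω, c ω]) (fun ω => [φ x y (c ω)]) := fun x y =>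
    (hc.ite (bit _ (φ x y true)) (bit _ (φ x y false))).congr fun ω => by cases c ω <;> rfl
  have h2 : ∀ x, Computes 16 (fun ω => [a ω, b ω, c ω]) (fun ω => [φ x (b ω) (c ω)]) := fun x =>
    (hb.ite (h3 x true) (h3 x false)).congr fun ω => by cases b ω <;> rfl
  exact (ha.ite (h2 true) (h2 false)).congr fun ω => by cases a ω <;> rfl

/-- Substitution of circuits: each gate is copied on top of `L`, an input gate being replaced by the
corresponding wire of `ins`, or by the constant `false` beyond its end. -/
theorem of_straightLine {L₀ : List (List Bool → Bool)} (h₀ : StraightLine L₀)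
    {L ins : List (List Bool → Bool)} (hL : StraightLine L) (hins : ∀ h ∈ ins, h ∈ L) :
    ∃ L', StraightLine L' ∧ L ⊆ L' ∧ L'.length ≤ L.length + L₀.length ∧
      ∀ g ∈ L₀, ∃ g' ∈ L', ∀ v, g' v = g (ins.map fun h => h v) := by
  induction h₀ with
  | nil => exact ⟨L, hL, fun _ h => h, by simp, by simp⟩
  | input L₁ i _ ih =>
    obtain ⟨L', h1, h2, h3, h4⟩ := ih
    by_cases hi : i < ins.length
    · refine ⟨L', h1, h2, by simp only [List.length_cons]; omega, ?_⟩
      rintro g (_ | ⟨_, hg⟩)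
      · exact ⟨ins[i], h2 (hins _ (List.getElem_mem hi)), fun v => by simp [hi]⟩
      · exact h4 g hg
    · refine ⟨(fun _ => false) :: L', .const L' false h1, fun x hx => by simp [h2 hx],
        by simp only [List.length_cons]; omega, ?_⟩
      rintro g (_ | ⟨_, hg⟩)
      · refine ⟨_, List.mem_cons_self, fun v => ?_⟩
        exact (List.getD_eq_default _ _ (by simpa using hi)).symm
      · obtain ⟨g', hg', hv⟩ := h4 g hg
        exact ⟨g', List.mem_cons_of_mem _ hg', hv⟩
  | const L₁ c _ ih =>
    obtain ⟨L', h1, h2, h3, h4⟩ := ih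
    refine ⟨(fun _ => c) :: L', .const L' c h1, fun x hx => by simp [h2 hx],
        by simp only [List.length_cons]; omega, ?_⟩
    rintro g (_ | ⟨_, hg⟩)
    · exact ⟨_, List.mem_cons_self, fun v => rfl⟩
    · obtain ⟨g', hg', hv⟩ := h4 g hg
      exact ⟨g', List.mem_cons_of_mem _ hg', hv⟩
  | nand L₁ p q _ hp hq ih =>
    obtain ⟨L', h1, h2, h3, h4⟩ := ih
    obtain ⟨p', hp', hpv⟩ := h4 p hp
    obtain ⟨q', hq', hqv⟩ := h4 q hq
    refine ⟨(fun v => !(p' v && q' v)) :: L', .nand L' p' q' h1 hp' hq',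
      fun x hx => by simp [h2 hx], by simp only [List.length_cons]; omega, ?_⟩
    rintro g (_ | ⟨_, hg⟩)
    · exact ⟨_, List.mem_cons_self, fun v => by rw [hpv, hqv]⟩
    · obtain ⟨g', hg', hv⟩ := h4 g hg
      exact ⟨g', List.mem_cons_of_mem _ hg', hv⟩

theorem of_hasCircuit {F : List Bool → List Bool} (hF : HasCircuit s F) (f : Ω → List Bool) :
    Computes s f fun ω => F (f ω) := by
  intro L ins hL hins
  obtain ⟨L₀, outs, h1, h2, h3, h4⟩ := hF
  obtain ⟨L', k1, k2, k3, k4⟩ := of_straightLine h1 hL hins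
  choose! φ hφ hv using k4
  refine ⟨L', outs.map φ, k1, k2, by omega, ?_, fun v ω h => ?_⟩
  · intro x hx
    obtain ⟨g, hg, rfl⟩ := List.mem_map.1 hx
    exact hφ g (h2 g hg)
  · simp only [h4, ← h, List.map_map]
    exact List.map_congr_left fun g hg => hv g (h2 g hg) v

/-- Passage back to closed circuits: the input gates are now paid for, once, as are the output
wires. Since the output wires are fixed, the output length is `m` even on strings that encode
nothing. -/
theorem hasCircuit [Nonempty Ω] (H : Computes s f g) {n m : ℕ} (hf : ∀ ω, (f ω).length = n)
    (hg : ∀ ω, (g ω).length = m) :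
    ∃ F, HasCircuit (n + s + m) F ∧ (∀ v, (F v).length = m) ∧ ∀ ω, F (f ω) = g ω := by
  have base : ∀ n, StraightLine ((List.range n).reverse.map fun i v => List.getD v i false) := by
    intro n
    induction n with
    | zero => exact .nil
    | succ n ih => rw [List.range_succ]; simpa using StraightLine.input _ n ih
  obtain ⟨L', outs, h1, h2, h3, h4, h5⟩ :=
    H _ ((List.range n).map fun i v => List.getD v i false) (base n) (by simp)
  simp only [List.length_map, List.length_reverse, List.length_range] at h3
  have key : ∀ ω, outs.map (fun h => h (f ω)) = g ω := fun ω => h5 _ ω <| by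
    apply List.ext_getElem
    · simp [hf]
    · intro i _ h2
      simp [h2]
  have hm : outs.length = m := by
    obtain ⟨ω⟩ := ‹Nonempty Ω›
    rw [← hg ω, ← key ω, List.length_map]
  exact ⟨fun v => outs.map fun h => h v, ⟨L', outs, h1, h4, by omega, fun _ => rfl⟩,
    fun v => by simp [hm], key⟩

end Computes

/-! ### Circuits for arithmetic modulo `N` -/

theorem length_natBits (w n : ℕ) : (natBits w n).length = w := by simp [natBits]

theorem natBits_succ (w n : ℕ) : natBits (w + 1) n = n.testBit 0 :: natBits w (n / 2) := by
  simp [natBits, List.range_succ_eq_map, Function.comp_def, Nat.testBit_succ]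

theorem natBits_succ' (w n : ℕ) : natBits (w + 1) n = natBits w n ++ [n.testBit w] := by
  simp [natBits, List.range_succ]

theorem natBits_congr {w a b : ℕ} (h : a % 2 ^ w = b % 2 ^ w) : natBits w a = natBits w b := by
  simp only [natBits, List.map_inj_left, List.mem_range]
  intro i hi
  have := congrArg (fun n => n.testBit i) h
  simpa [Nat.testBit_mod_two_pow, hi] using this

theorem natBits_take {v w : ℕ} (h : v ≤ w) (n : ℕ) : (natBits w n).take v = natBits v n := by
  simp [natBits, ← List.map_take, List.take_range, h]

namespace Computes

variable {Ω : Type} {s t u : ℕ} {f : Ω → List Bool}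

theorem natBits_of_bits {x : Ω → ℕ} {w : ℕ}
    (H : ∀ i < w, Computes s f fun ω => [(x ω).testBit i]) :
    Computes (w * s) f fun ω => natBits w (x ω) := by
  induction w with
  | zero => exact (nil f).mono (by simp)
  | succ w ih =>
    exact (((ih fun i hi => H i (by omega)).append (H w (by omega))).congr fun ω =>
      (natBits_succ' _ _).symm).mono (by ring_nf; omega)

theorem testBit {x : Ω → ℕ} {w i : ℕ} (H : Computes s f fun ω => natBits w (x ω)) (hi : i < w) :
    Computes s f fun ω => [(x ω).testBit i] :=
  ((H.take (i + 1)).drop i).congr fun ω => by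
    rw [natBits_take hi, natBits_succ', List.drop_left' (length_natBits _ _)]

theorem natBits_compl {x : Ω → ℕ} {w : ℕ} (H : Computes s f fun ω => natBits w (x ω))
    (hx : ∀ ω, x ω < 2 ^ w) : Computes (s + w) f fun ω => natBits w (2 ^ w - 1 - x ω) := by
  refine (H.trans (natBits_of_bits (s := 1) fun i hi => ?_)).mono (by simp)
  refine (((refl _).testBit hi).not).congr fun ω => ?_
  rw [Nat.sub_sub, add_comm 1, Nat.testBit_two_pow_sub_succ (hx ω)]
  simp [hi]

/-- Ripple-carry addition: the lowest sum bit is a parity and the next carry a majority, each of 36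
gates. The recursion runs on the halves, so the operands and the carry must be general. -/
theorem natBits_add_aux (w : ℕ) : ∀ (x y : Ω → ℕ) (c : Ω → Bool),
    Computes (72 * w) (fun ω => [c ω] ++ (natBits w (x ω) ++ natBits w (y ω)))
      fun ω => natBits w (x ω + y ω + (c ω).toNat) := by
  induction w with
  | zero => intro x y c; exact nil _
  | succ w ih =>
    intro x y c
    have h0 := refl fun ω => [c ω] ++ (natBits (w + 1) (x ω) ++ natBits (w + 1) (y ω))
    have hc := h0.left (n := 1) (by simp)
    have hx := (h0.right (n := 1) (by simp)).left fun ω => length_natBits _ _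
    have hy := (h0.right (n := 1) (by simp)).right fun ω => length_natBits _ _
    have hb : Computes 0 (fun ω => [c ω] ++ (natBits (w + 1) (x ω) ++ natBits (w + 1) (y ω)))
        fun ω => [c ω, (x ω).testBit 0, (y ω).testBit 0] :=
      (hc.append (((hx.take 1).append (hy.take 1)))).congr fun ω => by
        simp [natBits_succ]
    have hs := hb.bool₃ fun a b c => a ^^ (b ^^ c)
    have hk := hb.bool₃ fun a b c => (a && b) || ((b && c) || (a && c))
    have hr := (hk.append (((hx.drop 1).congr fun ω => show _ = natBits w (x ω / 2) by
      simp [natBits_succ]).append ((hy.drop 1).congr fun ω => show _ = natBits w (y ω / 2) by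
      simp [natBits_succ]))).trans (ih _ _ _)
    refine ((hs.append hr).congr fun ω => ?_).mono (by omega)
    rw [natBits_succ, List.singleton_append]
    congr 1
    · simp only [Nat.testBit_zero]
      rcases Nat.mod_two_eq_zero_or_one (x ω) with h1 | h1 <;>
      rcases Nat.mod_two_eq_zero_or_one (y ω) with h2 | h2 <;>
      cases c ω <;> simp [h1, h2] <;> omega
    · congr 1
      simp only [Nat.testBit_zero]
      rcases Nat.mod_two_eq_zero_or_one (x ω) with h1 | h1 <;>
      rcases Nat.mod_two_eq_zero_or_one (y ω) with h2 | h2 <;>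
      cases c ω <;> simp [h1, h2] <;> omega

theorem natBits_add {x y : Ω → ℕ} {c : Ω → Bool} {w : ℕ} (hc : Computes s f fun ω => [c ω])
    (hx : Computes t f fun ω => natBits w (x ω)) (hy : Computes u f fun ω => natBits w (y ω)) :
    Computes (s + t + u + 72 * w) f fun ω => natBits w (x ω + y ω + (c ω).toNat) :=
  ((hc.append (hx.append hy)).trans (natBits_add_aux w x y c)).mono (by omega)

theorem natBits_mask {c : Ω → Bool} {x : Ω → ℕ} {w : ℕ} (hc : Computes s f fun ω => [c ω])
    (hx : Computes t f fun ω => natBits w (x ω)) :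
    Computes (s + t + 10 * w) f fun ω => natBits w (if c ω then x ω else 0) := by
  refine ((hc.append hx).trans (natBits_of_bits (s := 10) fun i hi => ?_)).mono (by omega)
  have h0 := refl fun ω => [c ω] ++ natBits w (x ω)
  exact (((h0.left (n := 1) (by simp)).ite ((h0.right (n := 1) (by simp)).testBit hi)
    (bit _ false)).congr fun ω => by cases c ω <;> simp).mono (by omega)

end Computes

theorem enc_zmod {N : ℕ} [NeZero N] (z : ZMod N) : BitCode.enc z = natBits N.size z.val := rfl

/-- Subtraction modulo `N` by addition of the binary complement and conditional addition of `N`. -/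
theorem enc_zmod_sub {N : ℕ} [NeZero N] (x y : ZMod N) :
    BitCode.enc (x - y) = natBits N.size
      ((x.val + (2 ^ (N.size + 1) - 1 - y.val) + 1) +
        if (x.val + (2 ^ (N.size + 1) - 1 - y.val) + 1).testBit N.size then N else 0) := by
  rw [enc_zmod]
  have hx := x.val_lt
  have hy := y.val_lt
  have hN := Nat.lt_size_self N
  set w := N.size
  have hw : 2 ^ (w + 1) = 2 ^ w + 2 ^ w := by ring
  -- The integer is `x - y + 2 ^ (w + 1)` with `|x - y| < 2 ^ w`, so bit `w` is the borrow: it is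
  -- set exactly when `x < y`.
  rcases le_or_gt y.val x.val with h | h
  · have e : x.val + (2 ^ (w + 1) - 1 - y.val) + 1 = 2 ^ w * 2 + (x.val - y.val) := by omega
    have ht : (2 ^ w * 2 + (x.val - y.val)).testBit w = false := by
      rw [Nat.testBit_eq_decide_div_mod_eq, Nat.mul_add_div (by positivity),
        Nat.div_eq_of_lt (by omega)]
      simp
    rw [e, ht, ZMod.val_sub h]
    apply natBits_congr
    simp
  · have e : x.val + (2 ^ (w + 1) - 1 - y.val) + 1 = 2 ^ w * 1 + (2 ^ w + x.val - y.val) := by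
      omega
    have ht : (2 ^ w * 1 + (2 ^ w + x.val - y.val)).testBit w = true := by
      rw [Nat.testBit_eq_decide_div_mod_eq, Nat.mul_add_div (by positivity),
        Nat.div_eq_of_lt (by omega)]
      simp
    have hv : (x - y).val = N + x.val - y.val := by
      have h1 : x - y = -(y - x) := by ring
      have h2 : y - x ≠ 0 := by
        rw [sub_ne_zero]
        rintro rfl
        exact lt_irrefl _ h
      have : NeZero (y - x) := ⟨h2⟩
      rw [h1, ZMod.val_neg_of_ne_zero, ZMod.val_sub h.le]
      omega
    rw [e, ht, hv]
    apply natBits_congr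
    rw [show 2 ^ w * 1 + (2 ^ w + x.val - y.val) + (if true = true then N else 0) =
      (N + x.val - y.val) + 2 ^ w * 2 by simp only [if_true]; omega]
    simp

namespace Computes

variable {Ω : Type} {s t u : ℕ} {f : Ω → List Bool}

section Arithmetic

variable {N : ℕ} [NeZero N] {x y : Ω → ZMod N}

theorem enc_const {α : Type} [BitCode α] (f : Ω → List Bool) (a : α) :
    Computes (BitCode.len α) f fun _ => BitCode.enc a :=
  (const f (BitCode.enc a)).mono (BitCode.length_enc a).le

theorem zmod_sub (hx : Computes s f fun ω => BitCode.enc (x ω))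
    (hy : Computes t f fun ω => BitCode.enc (y ω)) :
    Computes (2 * s + 2 * t + 300 * (N.size + 1)) f fun ω => BitCode.enc (x ω - y ω) := by
  have hext : ∀ {r : ℕ} {z : Ω → ZMod N}, Computes r f (fun ω => BitCode.enc (z ω)) →
      Computes (r + 1) f fun ω => natBits (N.size + 1) (z ω).val := fun h =>
    (h.append (bit f false)).congr fun ω => by
      rw [natBits_succ', enc_zmod, Nat.testBit_lt_two_pow]
      exact (ZMod.val_lt _).trans (Nat.lt_size_self N)
  -- The incoming carry `true` supplies the `+ 1` of the two's complement; the extra digit makes the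
  -- borrow visible.
  have hd := (bit f true).natBits_add (hext hx) ((hext hy).natBits_compl fun ω =>
    ((ZMod.val_lt _).trans (Nat.lt_size_self N)).trans_le
      (Nat.pow_le_pow_right (by norm_num) (by omega)))
  have hd' : Computes _ f fun ω => natBits N.size (_ + 1) :=
    (hd.take N.size).congr fun ω => natBits_take (by omega) _
  have hN : Computes N.size f fun _ => natBits N.size N :=
    (const f (natBits N.size N)).mono (length_natBits _ _).le
  have hm := (hd.testBit (i := N.size) (by omega)).natBits_mask hN
  exact ((((bit f false).natBits_add hd' hm)).congr fun ω => by
    rw [enc_zmod_sub]; rfl).mono (by ring_nf; omega)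

/-- Addition is obtained as `x - (0 - y)`, hence the factor 4 on the second operand. -/
theorem zmod_add (hx : Computes s f fun ω => BitCode.enc (x ω))
    (hy : Computes t f fun ω => BitCode.enc (y ω)) :
    Computes (2 * s + 4 * t + 1000 * (N.size + 1)) f fun ω => BitCode.enc (x ω + y ω) := by
  have h0 : Computes N.size f fun _ => BitCode.enc (0 : ZMod N) :=
    enc_const f (0 : ZMod N)
  exact ((hx.zmod_sub (h0.zmod_sub hy)).congr fun ω => by simp).mono (by omega)

/-- Double and add: `x * n = 2 * (x * (n / 2)) + (n % 2) * x`, by recursion on the number of digits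
of the multiplier. -/
theorem zmod_mul_aux (w : ℕ) : ∀ n : Ω → ℕ,
    Computes (w * (4000 * (N.size + 1)) + N.size)
      (fun ω => BitCode.enc (x ω) ++ natBits w (n ω))
      fun ω => BitCode.enc (x ω * ((n ω % 2 ^ w : ℕ) : ZMod N)) := by
  induction w with
  | zero =>
    intro n
    exact ((enc_const _ (0 : ZMod N)).congr fun ω => by simp [Nat.mod_one]).mono (by simp; rfl)
  | succ w ih =>
    intro n
    have h0 := refl fun ω => BitCode.enc (x ω) ++ natBits (w + 1) (n ω)
    have hx := h0.left fun ω => BitCode.length_enc _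
    have hn := h0.right fun ω => BitCode.length_enc _
    have hr := (hx.append ((hn.drop 1).congr fun ω => show _ = natBits w (n ω / 2) by
      simp [natBits_succ])).trans (ih fun ω => n ω / 2)
    have hb := hn.testBit (i := 0) (by omega)
    have hm : Computes (10 * N.size) _ fun ω => BitCode.enc (if (n ω).testBit 0 then x ω else 0) :=
      ((hb.natBits_mask hx).congr fun ω => by
        rw [enc_zmod]
        by_cases h : (n ω).testBit 0 <;> simp [h]).mono (by omega)
    have hp := hr.append hm
    -- The partial product is first made available as wires. Applying `zmod_add` to it directly
    -- would double the size bound at each digit, which is exponential in `w`.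
    refine (hp.trans (h := fun ω => BitCode.enc (x ω * ((n ω % 2 ^ (w + 1) : ℕ) : ZMod N)))
      (t := 3000 * (N.size + 1)) ?_).mono
        (by ring_nf; omega)
    have ha := (refl fun ω => BitCode.enc (x ω * ((n ω / 2 % 2 ^ w : ℕ) : ZMod N)) ++
      BitCode.enc (if (n ω).testBit 0 then x ω else 0)).left fun ω => BitCode.length_enc _
    have hc := (refl fun ω => BitCode.enc (x ω * ((n ω / 2 % 2 ^ w : ℕ) : ZMod N)) ++
      BitCode.enc (if (n ω).testBit 0 then x ω else 0)).right fun ω => BitCode.length_enc _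
    refine (((ha.zmod_add ha).zmod_add hc).congr fun ω => ?_).mono (by omega)
    congr 1
    have e : n ω % 2 ^ (w + 1) = n ω % 2 + 2 * (n ω / 2 % 2 ^ w) := by
      rw [pow_succ', Nat.mod_mul]
    rw [e, Nat.testBit_zero]
    rcases Nat.mod_two_eq_zero_or_one (n ω) with h1 | h1 <;> simp [h1] <;> ring

theorem zmod_mul (hx : Computes s f fun ω => BitCode.enc (x ω))
    (hy : Computes t f fun ω => BitCode.enc (y ω)) :
    Computes (s + t + 5000 * (N.size + 1) ^ 2) f fun ω => BitCode.enc (x ω * y ω) := by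
  refine (((hx.append hy).trans (zmod_mul_aux N.size fun ω => (y ω).val)).congr fun ω => ?_).mono
    (by ring_nf; omega)
  rw [Nat.mod_eq_of_lt ((ZMod.val_lt _).trans (Nat.lt_size_self N)), ZMod.natCast_zmod_val]

end Arithmetic

/-! ### Circuits for tuples and matrices -/

section Tuples

variable {α β : Type} [BitCode α] [BitCode β]

theorem pair {a : Ω → α} {b : Ω → β} (ha : Computes s f fun ω => BitCode.enc (a ω))
    (hb : Computes t f fun ω => BitCode.enc (b ω)) :
    Computes (s + t) f fun ω => BitCode.enc (a ω, b ω) :=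
  ha.append hb

theorem fst {p : Ω → α × β} (h : Computes s f fun ω => BitCode.enc (p ω)) :
    Computes s f fun ω => BitCode.enc (p ω).1 :=
  left (h := fun ω => BitCode.enc (p ω).2) h fun _ => BitCode.length_enc _

theorem snd {p : Ω → α × β} (h : Computes s f fun ω => BitCode.enc (p ω)) :
    Computes s f fun ω => BitCode.enc (p ω).2 :=
  right (g := fun ω => BitCode.enc (p ω).1) h fun _ => BitCode.length_enc _

theorem entry {n : ℕ} {v : Ω → Fin n → α} (h : Computes s f fun ω => BitCode.enc (v ω)) (i : Fin n) :
    Computes s f fun ω => BitCode.enc (v ω i) := by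
  refine ((h.drop (i * BitCode.len α)).take (BitCode.len α)).congr fun ω => ?_
  have key : ∀ (n : ℕ) (v : Fin n → α) (i : Fin n),
      (((List.ofFn fun i => BitCode.enc (v i)).flatten).drop (i * BitCode.len α)).take
        (BitCode.len α) = BitCode.enc (v i) := by
    intro n
    induction n with
    | zero => intro v i; exact i.elim0
    | succ n ih =>
      intro v i
      rw [List.ofFn_succ, List.flatten_cons]
      cases i using Fin.cases with
      | zero => simp [List.take_left' (BitCode.length_enc (v 0))]
      | succ i =>
        rw [Fin.val_succ, add_mul, one_mul, add_comm, ← List.drop_drop,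
          List.drop_left' (BitCode.length_enc (v 0))]
        exact ih (fun i => v i.succ) i
  exact key n (v ω) i

theorem vector {n : ℕ} {v : Ω → Fin n → α} (h : ∀ i, Computes s f fun ω => BitCode.enc (v ω i)) :
    Computes (n * s) f fun ω => BitCode.enc (v ω) := by
  have key : ∀ (n : ℕ) (v : Ω → Fin n → α), (∀ i, Computes s f fun ω => BitCode.enc (v ω i)) →
      Computes (n * s) f fun ω => (List.ofFn fun i => BitCode.enc (v ω i)).flatten := by
    intro n
    induction n with
    | zero => intro v _; exact (nil f).mono (by simp)
    | succ n ih =>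
      intro v h
      exact (((h 0).append (ih (fun ω i => v ω i.succ) fun i => h i.succ)).congr fun ω => by
        rw [List.ofFn_succ, List.flatten_cons]).mono (by ring_nf; omega)
  exact key n v h

theorem matrix_entry {a b : ℕ} {M : Ω → Matrix (Fin a) (Fin b) α}
    (h : Computes s f fun ω => BitCode.enc (M ω)) (i : Fin a) (j : Fin b) :
    Computes s f fun ω => BitCode.enc (M ω i j) :=
  entry (v := fun ω => M ω i) (entry (v := fun ω => (M ω : Fin a → Fin b → α)) h i) j

theorem matrix {a b : ℕ} {M : Ω → Matrix (Fin a) (Fin b) α}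
    (h : ∀ i j, Computes s f fun ω => BitCode.enc (M ω i j)) :
    Computes (a * (b * s)) f fun ω => BitCode.enc (M ω) :=
  vector (v := fun ω => (M ω : Fin a → Fin b → α)) fun i => vector fun j => h i j

theorem matrix_update {a b : ℕ} {M : Ω → Matrix (Fin a) (Fin b) α} {v : Ω → α}
    (h : Computes 0 f fun ω => BitCode.enc (M ω)) (hv : Computes 0 f fun ω => BitCode.enc (v ω))
    (i : Fin a) (j : Fin b) :
    Computes 0 f fun ω => BitCode.enc
      ((M ω).updateRow i (Function.update (M ω i) j (v ω))) := by
  refine (matrix (s := 0) fun i' j' => ?_).mono (by simp)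
  by_cases hi : i' = i
  · subst hi
    by_cases hj : j' = j
    · subst hj
      exact hv.congr fun ω => by simp
    · exact (h.matrix_entry i' j').congr fun ω => by simp [Matrix.updateRow_apply, hj]
  · exact (h.matrix_entry i' j').congr fun ω => by simp [Matrix.updateRow_apply, hi]

end Tuples

end Computes

/-! ### Acceptance probabilities -/

section Prob

variable {α β γ : Type*}

theorem bind_congr_of_mem_support (P : PMF α) {f g : α → PMF β} (h : ∀ a ∈ P.support, f a = g a) :
    P.bind f = P.bind g := by
  ext b
  rw [PMF.bind_apply, PMF.bind_apply]
  refine tsum_congr fun a => ?_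
  by_cases ha : P a = 0
  · simp [ha]
  · rw [h a ((P.mem_support_iff a).2 ha)]

/-- The probability that the test `d` accepts a sample of `P`. -/
def prob (P : PMF α) (d : α → Bool) : ℝ := ((P.map d) true).toReal

theorem prob_map (P : PMF α) (f : α → β) (d : β → Bool) :
    prob (P.map f) d = prob P fun a => d (f a) := by
  rw [prob, PMF.map_comp]; rfl

theorem prob_nonneg (P : PMF α) (d : α → Bool) : 0 ≤ prob P d := ENNReal.toReal_nonneg

theorem prob_le_one (P : PMF α) (d : α → Bool) : prob P d ≤ 1 :=
  ENNReal.toReal_le_of_le_ofReal zero_le_one (by rw [ENNReal.ofReal_one]; exact PMF.coe_le_one _ _)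

theorem prob_bind (P : PMF α) (f : α → PMF β) (d : β → Bool) :
    prob (P.bind f) d = ∑' a, (P a).toReal * prob (f a) d := by
  rw [prob, PMF.map_bind, PMF.bind_apply, ENNReal.tsum_toReal_eq]
  · simp [prob, ENNReal.toReal_mul]
  · exact fun a => ENNReal.mul_ne_top (PMF.apply_ne_top _ _) (PMF.apply_ne_top _ _)

theorem summable_toReal (P : PMF α) : Summable fun a => (P a).toReal :=
  ENNReal.summable_toReal P.tsum_coe_ne_top

theorem summable_prob (P : PMF α) (f : α → PMF β) (d : β → Bool) :
    Summable fun a => (P a).toReal * prob (f a) d :=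
  (summable_toReal P).of_nonneg_of_le
    (fun _ => mul_nonneg ENNReal.toReal_nonneg (prob_nonneg _ _))
    fun _ => mul_le_of_le_one_right ENNReal.toReal_nonneg (prob_le_one _ _)

theorem prob_congr (P : PMF α) {d e : α → Bool} (h : ∀ a ∈ P.support, d a = e a) :
    prob P d = prob P e := by
  have : P.map d = P.map e := bind_congr_of_mem_support P fun a ha => by simp [h a ha]
  rw [prob, this, prob]

/-- Averaging: a bound that holds for each value of a common random variable holds for the mixtures.
This is what allows randomness to be fixed and hardwired. -/
theorem abs_prob_bind_sub_le (P : PMF α) (f : α → PMF β) (g : α → PMF γ) (d : β → Bool)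
    (e : γ → Bool) {ε : ℝ} (h : ∀ a ∈ P.support, |prob (f a) d - prob (g a) e| ≤ ε) :
    |prob (P.bind f) d - prob (P.bind g) e| ≤ ε := by
  have hP1 : ∑' a, (P a).toReal = 1 := by
    rw [← ENNReal.tsum_toReal_eq fun a => P.apply_ne_top a, P.tsum_coe, ENNReal.toReal_one]
  rw [prob_bind, prob_bind, ← (summable_prob P f d).tsum_sub (summable_prob P g e), ← Real.norm_eq_abs]
  refine tsum_of_norm_bounded (g := fun a => (P a).toReal * ε) ?_ fun a => ?_
  · simpa [hP1] using (summable_toReal P).hasSum.mul_right ε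
  · rw [← mul_sub, norm_mul, Real.norm_of_nonneg ENNReal.toReal_nonneg, Real.norm_eq_abs]
    by_cases ha : P a = 0
    · simp [ha]
    · exact mul_le_mul_of_nonneg_left (h a ((P.mem_support_iff a).2 ha)) ENNReal.toReal_nonneg

end Prob

/-! ### Random tapes -/

theorem coins_append (μ ν : List ℕ) :
    coins (μ ++ ν) = (coins μ).bind fun r => (coins ν).map fun r' => r ++ r' := by
  induction μ with
  | nil => simpa [coins] using (show coins ν = (coins ν).map fun r => r from
    (PMF.map_id (coins ν)).symm)
  | cons n μ ih =>
    simp only [List.cons_append, coins, ih, PMF.bind_bind, PMF.map_bind, PMF.bind_map]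
    congr 1
    funext r
    congr 1
    funext c
    simp [PMF.map_comp, Function.comp_def]

theorem length_of_mem_coins {μ : List ℕ} {r : List Bool} (h : r ∈ (coins μ).support) :
    r.length = (μ.map Nat.size).sum := by
  induction μ generalizing r with
  | nil => simp_all [coins]
  | cons n μ ih =>
    simp only [coins, PMF.mem_support_bind_iff, PMF.mem_support_map_iff] at h
    obtain ⟨u, _, c, hc, rfl⟩ := h
    simp [ih hc, length_natBits]

theorem mem_coins_append {μ ν : List ℕ} {r : List Bool} (h : r ∈ (coins (μ ++ ν)).support) :
    r.take (μ.map Nat.size).sum ∈ (coins μ).support ∧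
      r.drop (μ.map Nat.size).sum ∈ (coins ν).support := by
  rw [coins_append] at h
  simp only [PMF.mem_support_bind_iff, PMF.mem_support_map_iff] at h
  obtain ⟨u, hu, c, hc, rfl⟩ := h
  rw [List.take_left' (length_of_mem_coins hu), List.drop_left' (length_of_mem_coins hu)]
  exact ⟨hu, hc⟩

/-! ### Views -/

namespace Protocol

variable {S T U V : Bool → Type}

/-- The joint distribution of the final states and of the transcript of party `b`. -/
def view (p : Protocol S T) (b : Bool) (s : ∀ b, S b) : PMF ((∀ b, T b) × List Bool) :=
  (p.run s).map fun r => (r.1, r.2 b)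

theorem view_seq (p : Protocol S T) (q : Protocol T U) (b : Bool) (s : ∀ b, S b) :
    (seq p q).view b s =
      (p.view b s).bind fun r => (q.view b r.1).map fun r' => (r'.1, r.2 ++ r'.2) := by
  simp only [view, run, PMF.map_bind, PMF.bind_map, PMF.map_comp]
  rfl

theorem view_compute (f : ∀ b, S b → T b) (b : Bool) (s : ∀ b, S b) :
    (compute f).view b s = PMF.pure (fun b => f b (s b), []) := by
  simp [view, run, PMF.pure_map]

theorem view_frame (R : Bool → Type) (p : Protocol S T) (b : Bool) (s : ∀ b, S b × R b) :
    (frame R p).view b s =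
      (p.view b fun b => (s b).1).map fun r => (fun b => (r.1 b, (s b).2), r.2) := by
  simp only [view, run, PMF.map_comp]
  rfl

theorem view_seq_assoc (p : Protocol S T) (q : Protocol T U) (r : Protocol U V) (b : Bool)
    (s : ∀ b, S b) : (seq p (seq q r)).view b s = (seq (seq p q) r).view b s := by
  simp only [view_seq, PMF.map_bind, PMF.bind_bind, PMF.bind_map, PMF.map_comp]
  simp [Function.comp_def]

theorem length_of_mem_run (p : Protocol S T) (b : Bool) {s : ∀ b, S b}
    {r : (∀ b, T b) × (Bool → List Bool)} (h : r ∈ (p.run s).support) :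
    (r.2 b).length = p.transcriptLen b := by
  induction p with
  | compute f => simp_all [run, transcriptLen]
  | deal B d =>
    simp only [run, PMF.mem_support_map_iff] at h
    obtain ⟨u, _, rfl⟩ := h
    simp [transcriptLen, BitCode.length_enc]
  | exchange B msg => 
    simp only [run, PMF.mem_support_pure_iff] at h
    subst h
    simp [transcriptLen, BitCode.length_enc]
  | seq p q ihp ihq =>
    simp only [run, PMF.mem_support_bind_iff, PMF.mem_support_map_iff] at h
    obtain ⟨u, hu, u', hu', rfl⟩ := h
    simp [transcriptLen, ihp hu, ihq hu']
  | frame R p ih =>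
    simp only [run, PMF.mem_support_map_iff] at h
    obtain ⟨u, hu, rfl⟩ := h
    exact ih hu

theorem length_of_mem_view (p : Protocol S T) (b : Bool) {s : ∀ b, S b}
    {r : (∀ b, T b) × List Bool} (h : r ∈ (p.view b s).support) :
    r.2.length = p.transcriptLen b := by
  simp only [view, PMF.mem_support_map_iff] at h
  obtain ⟨u, hu, rfl⟩ := h
  exact p.length_of_mem_run b hu

end Protocol

/-! ### Simulation of protocols with private states -/

section Simulation

variable {S T U V : Bool → Type} [∀ b, BitCode (S b)] [∀ b, BitCode (T b)] [∀ b, BitCode (U b)]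
  [∀ b, BitCode (V b)]

/-- The encoding of a pair of states, that of party `b` first. -/
def stateBits (b : Bool) (s : ∀ b, S b) : List Bool := BitCode.enc (s b) ++ BitCode.enc (s !b)

/-- The encoding of a transcript and of a pair of states. -/
def viewBits (b : Bool) (r : (∀ b, T b) × List Bool) : List Bool := r.2 ++ stateBits b r.1

/-- The test `d` of transcripts of length `n` and states has a circuit with `σ` gates. -/
def HasTestCircuit (b : Bool) (n σ : ℕ) (d : (∀ b, T b) × List Bool → Bool) : Prop :=
  Computes σ (fun r : {r : (∀ b, T b) × List Bool // r.2.length = n} => viewBits b r.1)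
    fun r => [d r.1]

/-- A relation between circuit sizes and bounds on the advantage of distinguishers of that size. -/
structure AdvantageBound where
  holds : ℕ → ℝ → Prop
  nonneg : ∀ {σ ε}, holds σ ε → 0 ≤ ε
  anti : ∀ {σ σ' ε}, σ ≤ σ' → holds σ' ε → holds σ ε

/-- The function `I` computes, from the initial states and a random tape distributed according to
`coins μ`, final states and a transcript of party `b` that look like those of the protocol `p`.
The number `c` bounds circuit sizes, the advantage of distinguishers as a multiple of the advantage
in `H`, and the growth of distinguishers in the reduction to `H`. The relation `R` holds between
initial and final states. -/
structure IsSimulation (H : AdvantageBound) (b : Bool) (p : Protocol S T)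
    (R : (∀ b, S b) → (∀ b, T b) → Prop) (c : ℕ) (μ : List ℕ)
    (I : (∀ b, S b) → List Bool → (∀ b, T b) × List Bool) : Prop where
  local_left : ∀ s s' r, s b = s' b → (I s r).1 b = (I s' r).1 b
  local_right : ∀ s s' r, s b = s' b → (I s r).2 = (I s' r).2
  length_eq : ∀ s r, (I s r).2.length = p.transcriptLen b
  rel : ∀ s r, R s (I s r).1
  transcriptLen_le : p.transcriptLen b ≤ c
  coins_le : (μ.map Nat.size).sum ≤ c
  computes : Computes c (fun ω : (∀ b, S b) × {r // r ∈ (coins μ).support} =>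
    BitCode.enc (ω.1 b) ++ ω.2.1) fun ω => (I ω.1 ω.2.1).2 ++ BitCode.enc ((I ω.1 ω.2.1).1 b)
  computes_joint : ∀ r ∈ (coins μ).support, Computes c (stateBits b) fun s => viewBits b (I s r)
  indist : ∀ σ ε, H.holds (σ + c) ε → ∀ d, HasTestCircuit b (p.transcriptLen b) σ d → ∀ s,
    |prob (p.view b s) d - prob ((coins μ).map (I s)) d| ≤ c * ε

/-- See `IsSimulation`. -/
def Simulatable (H : AdvantageBound) (b : Bool) (p : Protocol S T)
    (R : (∀ b, S b) → (∀ b, T b) → Prop) (c : ℕ) : Prop :=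
  ∃ μ I, IsSimulation H b p R c μ I

variable {H : AdvantageBound} {b : Bool}

theorem Simulatable.mono {p : Protocol S T} {R R' : (∀ b, S b) → (∀ b, T b) → Prop} {c c' : ℕ}
    (h : Simulatable H b p R c) (hc : c ≤ c') (hR : ∀ s t, R s t → R' s t) :
    Simulatable H b p R' c' := by
  obtain ⟨μ, I, h⟩ := h
  refine ⟨μ, I, h.local_left, h.local_right, h.length_eq, fun s r => hR _ _ (h.rel s r),
    h.transcriptLen_le.trans hc, h.coins_le.trans hc, h.computes.mono hc,
    fun r hr => (h.computes_joint r hr).mono hc, fun σ ε hH d hd s => ?_⟩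
  refine (h.indist σ ε (H.anti (by omega) hH) d hd s).trans ?_
  exact mul_le_mul_of_nonneg_right (by exact_mod_cast hc) (H.nonneg hH)

theorem Simulatable.congr {p q : Protocol S T} {R : (∀ b, S b) → (∀ b, T b) → Prop} {c : ℕ}
    (h : Simulatable H b p R c) (hv : ∀ s, p.view b s = q.view b s)
    (hl : p.transcriptLen b = q.transcriptLen b) : Simulatable H b q R c := by
  obtain ⟨μ, I, h⟩ := h
  exact ⟨μ, I, h.local_left, h.local_right, fun s r => (h.length_eq s r).trans hl, h.rel,
    hl ▸ h.transcriptLen_le, h.coins_le, h.computes, h.computes_joint,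
    fun σ ε hH d hd s => by rw [← hv]; exact h.indist σ ε hH d (by rwa [hl]) s⟩

/-- The simulation is the computation itself and has advantage zero; the factor 2 pays for the
circuits of both parties. -/
theorem Simulatable.compute (H : AdvantageBound) (f : ∀ b, S b → T b) {c : ℕ}
    (hf : ∀ b', Computes c (fun s => BitCode.enc s) fun s => BitCode.enc (f b' s)) :
    Simulatable H b (.compute f) (fun s t => ∀ b, t b = f b (s b)) (2 * c) := by
  refine ⟨[], fun s _ => (fun b => f b (s b), []), fun s s' _ h => by simp [h], fun _ _ _ _ => rfl,
    fun _ _ => rfl, fun _ _ _ => rfl, by simp [Protocol.transcriptLen], by simp, ?_, fun r _ => ?_,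
    fun σ ε hH d hd s => ?_⟩
  · refine Computes.mono (s := c) ?_ (by omega)
    refine Computes.congr (g := fun ω => BitCode.enc (f b (ω.1 b))) ?_ fun ω => by simp
    exact ((((Computes.refl _).left fun _ => BitCode.length_enc _).trans
      ((hf b).reindex _))).mono (by omega)
  · have h1 := ((Computes.refl (stateBits (S := S) b)).left fun _ => BitCode.length_enc _).trans
      ((hf b).reindex fun s : ∀ b, S b => s b)
    have h2 := ((Computes.refl (stateBits (S := S) b)).right fun _ => BitCode.length_enc _).trans
      ((hf !b).reindex fun s : ∀ b, S b => s !b)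
    exact ((h1.append h2).congr fun s => by simp [viewBits, stateBits]).mono (by omega)
  · rw [Protocol.view_compute, coins, PMF.pure_map, sub_self, abs_zero]
    exact mul_nonneg (Nat.cast_nonneg _) (H.nonneg hH)

/-- A known beginning of the transcript is hardwired, at one constant gate per bit. -/
theorem HasTestCircuit.prefix {n₁ n₂ σ : ℕ} {d : (∀ b, T b) × List Bool → Bool}
    (hd : HasTestCircuit b (n₁ + n₂) σ d) {l : List Bool} (hl : l.length = n₁) :
    HasTestCircuit b n₂ (σ + n₁) fun r => d (r.1, l ++ r.2) := by
  have h := hd.reindex fun r : {r : (∀ b, T b) × List Bool // r.2.length = n₂} =>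
    ⟨(r.1.1, l ++ r.1.2), by simp [hl, r.2]⟩
  refine Computes.mono (s := n₁ + σ) (Computes.trans ?_ h) (by omega)
  refine Computes.mono (s := l.length + 0) ?_ (by omega)
  exact ((Computes.const _ l).append (Computes.refl _)).congr fun r => by simp [viewBits]

/-- The hybrid runs `p` and simulates `q` from the real intermediate states. The tape is split
between the two simulations, and locality of the first gives the second the state of party `b` that
it needs. -/
theorem Simulatable.seq {p : Protocol S T} {q : Protocol T U}
    {R : (∀ b, S b) → (∀ b, T b) → Prop} {R' : (∀ b, T b) → (∀ b, U b) → Prop} {c c' : ℕ}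
    (hp : Simulatable H b p R c) (hq : Simulatable H b q R' c') :
    Simulatable H b (.seq p q) (fun s u => ∃ t, R s t ∧ R' t u) (c + c') := by
  obtain ⟨μ, I, hp⟩ := hp
  obtain ⟨ν, J, hq⟩ := hq
  set n := (μ.map Nat.size).sum with hn
  have hlen : (Protocol.seq p q).transcriptLen b = p.transcriptLen b + q.transcriptLen b := rfl
  refine ⟨μ ++ ν, fun s r => ((J (I s (r.take n)).1 (r.drop n)).1,
    (I s (r.take n)).2 ++ (J (I s (r.take n)).1 (r.drop n)).2), ?_, ?_, ?_, ?_, ?_, ?_, ?_, ?_, ?_⟩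
  · intro s s' r h
    exact hq.local_left _ _ _ (hp.local_left _ _ _ h)
  · intro s s' r h
    exact congrArg₂ _ (hp.local_right _ _ _ h) (hq.local_right _ _ _ (hp.local_left _ _ _ h))
  · intro s r
    simp [hlen, hp.length_eq, hq.length_eq]
  · exact fun s r => ⟨_, hp.rel _ _, hq.rel _ _⟩
  · have := hp.transcriptLen_le
    have := hq.transcriptLen_le
    omega
  · have := hp.coins_le
    have := hq.coins_le
    simp only [List.map_append, List.sum_append]
    omega
  · have h1 := hp.computes.reindex
      fun ω : (∀ b, S b) × {r // r ∈ (coins (μ ++ ν)).support} =>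
        (ω.1, ⟨ω.2.1.take n, (mem_coins_append ω.2.2).1⟩)
    have h2 := hq.computes.reindex
      fun ω : (∀ b, S b) × {r // r ∈ (coins (μ ++ ν)).support} =>
        ((I ω.1 (ω.2.1.take n)).1, ⟨ω.2.1.drop n, (mem_coins_append ω.2.2).2⟩)
    have h0 := Computes.refl fun ω : (∀ b, S b) × {r // r ∈ (coins (μ ++ ν)).support} =>
      BitCode.enc (ω.1 b) ++ ω.2.1
    have ha := h0.left fun _ => BitCode.length_enc _
    have hr := h0.right fun _ => BitCode.length_enc _
    have h3 := (((ha.append (hr.take n)).trans h1).append (hr.drop n)).congr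
      (h := fun ω => (I ω.1 (ω.2.1.take n)).2 ++
        (BitCode.enc ((I ω.1 (ω.2.1.take n)).1 b) ++ ω.2.1.drop n)) fun ω => by simp
    have h4 := Computes.refl fun ω : (∀ b, S b) × {r // r ∈ (coins (μ ++ ν)).support} =>
      (I ω.1 (ω.2.1.take n)).2 ++ (BitCode.enc ((I ω.1 (ω.2.1.take n)).1 b) ++ ω.2.1.drop n)
    have h5 := (h4.left fun _ => hp.length_eq _ _).append
      ((h4.right fun _ => hp.length_eq _ _).trans h2)
    exact ((h3.trans h5).congr fun ω => by simp).mono (by omega)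
  · intro r hr
    have h1 := hp.computes_joint _ (mem_coins_append hr).1
    have h2 := (hq.computes_joint _ (mem_coins_append hr).2).reindex
      fun s : ∀ b, S b => (I s (r.take n)).1
    have h4 := Computes.refl fun s => viewBits b (I s (r.take n))
    have h5 := (h4.left fun _ => hp.length_eq _ _).append
      ((h4.right fun _ => hp.length_eq _ _).trans h2)
    exact ((h1.trans h5).congr fun s => by simp [viewBits, hn]).mono (by omega)
  · intro σ ε hH d hd s
    rw [hlen] at hd
    -- Real execution against hybrid: for each outcome of `p` its transcript is hardwired, which is
    -- affordable because its length is at most `c`.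
    have hreal : |prob ((Protocol.seq p q).view b s) d - prob ((p.view b s).bind fun r =>
        (coins ν).map fun x => ((J r.1 x).1, r.2 ++ (J r.1 x).2)) d| ≤ c' * ε := by
      rw [Protocol.view_seq]
      refine abs_prob_bind_sub_le _ _ _ _ _ fun r hr => ?_
      have hd' := hd.prefix (p.length_of_mem_view b hr)
      have := hq.indist _ ε (H.anti (by have := hp.transcriptLen_le; omega) hH) _ hd' r.1
      rw [prob_map] at this ⊢
      rwa [prob_map]
    -- Hybrid against full simulation: the tape `x` of the second simulation is drawn first and
    -- fixed, so the map `J · x` becomes part of the distinguisher. Here the circuit for both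
    -- states, `computes_joint`, is used.
    have hideal : |prob ((p.view b s).bind fun r =>
        (coins ν).map fun x => ((J r.1 x).1, r.2 ++ (J r.1 x).2)) d -
        prob ((coins (μ ++ ν)).map fun r => ((J (I s (r.take n)).1 (r.drop n)).1,
          (I s (r.take n)).2 ++ (J (I s (r.take n)).1 (r.drop n)).2)) d| ≤ c * ε := by
      have e1 : ((p.view b s).bind fun r =>
          (coins ν).map fun x => ((J r.1 x).1, r.2 ++ (J r.1 x).2)) =
          (coins ν).bind fun x => (p.view b s).map
            fun r : (∀ b, T b) × List Bool => ((J r.1 x).1, r.2 ++ (J r.1 x).2) :=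
        PMF.bind_comm _ _ fun (r : (∀ b, T b) × List Bool) x => PMF.pure ((J r.1 x).1, r.2 ++ (J r.1 x).2)
      have e2 : ((coins (μ ++ ν)).map fun r => ((J (I s (r.take n)).1 (r.drop n)).1,
          (I s (r.take n)).2 ++ (J (I s (r.take n)).1 (r.drop n)).2)) =
          (coins ν).bind fun x => ((coins μ).map (I s)).map
            fun r : (∀ b, T b) × List Bool => ((J r.1 x).1, r.2 ++ (J r.1 x).2) := by
        have e3 : ((coins ν).bind fun x => ((coins μ).map (I s)).map
            fun r : (∀ b, T b) × List Bool => ((J r.1 x).1, r.2 ++ (J r.1 x).2)) =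
            (coins μ).bind fun y => (coins ν).map fun x => ((J (I s y).1 x).1, (I s y).2 ++ (J (I s y).1 x).2) := by
          simp only [PMF.map_comp]
          exact PMF.bind_comm _ _ fun x y =>
            PMF.pure ((J (I s y).1 x).1, (I s y).2 ++ (J (I s y).1 x).2)
        rw [e3, coins_append, PMF.map_bind]
        refine bind_congr_of_mem_support _ fun y hy => ?_
        rw [PMF.map_comp]
        congr 1
        funext x
        simp only [Function.comp_apply, List.take_left' (length_of_mem_coins hy),
          List.drop_left' (length_of_mem_coins hy), hn]
      rw [e1, e2]
      refine abs_prob_bind_sub_le _ _ _ _ _ fun x hx => ?_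
      have hd' : HasTestCircuit b (p.transcriptLen b) (c' + σ)
          fun r => d ((J r.1 x).1, r.2 ++ (J r.1 x).2) := by
        have h := hd.reindex
          fun r : {r : (∀ b, T b) × List Bool // r.2.length = p.transcriptLen b} =>
            ⟨((J r.1.1 x).1, r.1.2 ++ (J r.1.1 x).2), by simp [r.2, hq.length_eq]⟩
        refine Computes.trans ?_ h
        have h4 := Computes.refl
          fun r : {r : (∀ b, T b) × List Bool // r.2.length = p.transcriptLen b} => viewBits b r.1
        have h5 := (h4.left fun r => r.2).append ((h4.right fun r => r.2).trans
          ((hq.computes_joint x hx).reindex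
            fun r : {r : (∀ b, T b) × List Bool // r.2.length = p.transcriptLen b} => r.1.1))
        exact (h5.congr fun r => by simp [viewBits]).mono (by omega)
      have := hp.indist _ ε (H.anti (by omega) hH) _ hd' s
      rwa [prob_map (p.view b s), prob_map ((coins μ).map (I s))]
    calc _ ≤ c' * ε + c * ε := (abs_sub_le _ _ _).trans (add_le_add hreal hideal)
      _ = _ := by push_cast; ring

/-- The effect of a pass is recorded by an element of a commutative monoid, so that the loop has the
sum of the effects. -/
theorem Simulatable.forEach {ι G : Type} [AddCommMonoid G] {p : ι → Protocol S S}
    {Q : G → (∀ b, S b) → (∀ b, S b) → Prop} (h0 : ∀ s, Q 0 s s)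
    (hadd : ∀ g g' s t u, Q g s t → Q g' t u → Q (g + g') s u) {δ : ι → G} {c n : ℕ}
    (hp : ∀ i, Simulatable H b (p i) (Q (δ i)) c) {L : List ι} (hL : L.length ≤ n) :
    Simulatable H b (.forEach p L) (Q (L.map δ).sum) (n * c) := by
  suffices h : Simulatable H b (.forEach p L) (Q (L.map δ).sum) (L.length * c) from
    h.mono (Nat.mul_le_mul_right c hL) fun _ _ h => h
  clear hL
  induction L with
  | nil =>
    refine (Simulatable.compute H (fun _ s => s) (c := 0) fun _ => Computes.refl _).mono
      (by simp) fun s t h => ?_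
    obtain rfl : t = s := funext h
    exact h0 _
  | cons i L ih =>
    refine ((hp i).seq ih).mono (by simp only [List.length_cons]; ring_nf; omega) ?_
    rintro s u ⟨t, h1, h2⟩
    simpa using hadd _ _ _ _ _ h1 h2

end Simulation

theorem Simulatable.seq_assoc {S T U V : Bool → Type} [∀ b, BitCode (S b)] [∀ b, BitCode (V b)]
    {H : AdvantageBound} {b : Bool} {p : Protocol S T} {q : Protocol T U} {r : Protocol U V}
    {R : (∀ b, S b) → (∀ b, V b) → Prop} {c : ℕ} (h : Simulatable H b (.seq (.seq p q) r) R c) :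
    Simulatable H b (.seq p (.seq q r)) R c :=
  h.congr (fun s => (Protocol.view_seq_assoc p q r b s).symm) (Nat.add_assoc _ _ _)

/-! ### Secure protocols as parts of larger protocols -/

theorem HasCircuit.mono {s t : ℕ} {F : List Bool → List Bool} (h : HasCircuit s F) (hst : s ≤ t) :
    HasCircuit t F := by
  obtain ⟨L, outs, h1, h2, h3, h4⟩ := h
  exact ⟨L, outs, h1, h2, by omega, h4⟩

theorem Computes.exists_test {Ω : Type} [Nonempty Ω] {s n : ℕ} {f : Ω → List Bool} {d : Ω → Bool}
    (H : Computes s f fun ω => [d ω]) (hf : ∀ ω, (f ω).length = n) :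
    ∃ D : List Bool → Bool, HasCircuit (n + s + 1) (fun v => [D v]) ∧ ∀ ω, D (f ω) = d ω := by
  obtain ⟨F, h1, h2, h3⟩ := H.hasCircuit hf (m := 1) fun _ => rfl
  refine ⟨fun v => (F v).headD false, ?_, fun ω => by simp [h3]⟩
  convert h1 using 2 with v
  obtain ⟨c, hc⟩ := List.length_eq_one_iff.1 (h2 v)
  simp [hc]

/-- A simulator of a protocol that is given by circuits of size at most `n`. -/
structure IsSimulator {A : Bool → Type} [∀ b, BitCode (A b)] {G : Type} [BitCode G] [Sub G]
    (H : AdvantageBound) (b : Bool) (p : Protocol A fun _ => G) (f : (∀ b, A b) → G) (n : ℕ)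
    (μ : List ℕ) (sim : A b → List Bool → List Bool × G) : Prop where
  length_eq : ∀ a r, (sim a r).1.length = p.transcriptLen b
  transcriptLen_le : p.transcriptLen b ≤ n
  coins_le : (μ.map Nat.size).sum ≤ n
  circuit : ∃ F, HasCircuit n F ∧ ∀ a, ∀ r ∈ (coins μ).support,
    F (BitCode.enc a ++ r) = (sim a r).1 ++ BitCode.enc (sim a r).2
  advantage_le : ∀ σ ε, H.holds σ ε → ∀ D, HasCircuit σ (fun v => [D v]) → ∀ x,
    advantage D (real p x b) (ideal b μ sim x (f x)) ≤ ε

theorem advantage_eq_abs_prob_sub (D : List Bool → Bool) (P Q : PMF (List Bool)) :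
    advantage D P Q = |prob P D - prob Q D| := rfl

/-- The share of the honest party is defined as `f` minus the simulated share, so the shares sum to
`f` exactly. The circuit in `hf` lets later reductions compute that share from both states. A
distinguisher may depend on the initial states, so the parts set aside are constants for it. -/
theorem IsSimulator.simulatable_frame {A : Bool → Type} [∀ b, BitCode (A b)] {G : Type} [BitCode G]
    [AddCommGroup G] {H : AdvantageBound} {b : Bool} {p : Protocol A fun _ => G}
    {f : (∀ b, A b) → G} {n : ℕ} {μ : List ℕ} {sim : A b → List Bool → List Bool × G}
    (hsim : IsSimulator H b p f n μ sim) {e : ℕ}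
    (hf : Computes e (fun ω : (∀ b, A b) × G => stateBits b ω.1 ++ BitCode.enc ω.2)
      fun ω => BitCode.enc (f ω.1 - ω.2))
    (R : Bool → Type) [∀ b, BitCode (R b)] :
    Simulatable (S := fun b => A b × R b) (T := fun b => G × R b) H b (.frame R p)
      (fun s t => (t false).1 + (t true).1 = f (fun b => (s b).1) ∧ ∀ b, (t b).2 = (s b).2)
      (3 * n + e + BitCode.len (A b) + 2 * BitCode.len G + BitCode.len (R b) +
        BitCode.len (R !b) + 1) := by
  have hlen : (Protocol.frame R p).transcriptLen b = p.transcriptLen b := rfl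
  obtain ⟨F, hF, hFs⟩ := hsim.circuit
  set I : (∀ b, A b × R b) → List Bool → (∀ b, G × R b) × List Bool := fun s r =>
    (fun b' => (if b' = b then (sim (s b).1 r).2 else f (fun b => (s b).1) - (sim (s b).1 r).2,
      (s b').2), (sim (s b).1 r).1) with hI
  have hn := hsim.transcriptLen_le
  have hite : ∀ (x : Bool → G) (y : ∀ b, R b),
      (fun b' => (if b' = b then x b else x !b, y b') : ∀ b, G × R b) = fun b' => (x b', y b') := by
    intro x y
    funext b'
    cases b <;> cases b' <;> rfl
  refine ⟨μ, I, fun s s' r h => ?_, fun s s' r h => ?_, fun s r => hsim.length_eq _ _,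
    fun s r => ⟨?_, fun _ => rfl⟩, ?_, hsim.coins_le.trans (by omega), ?_, fun r hr => ?_,
    fun σ ε hH d hd s => ?_⟩
  · simp [hI, h]
  · simp [hI, h]
  · cases b <;> simp [hI]
  · omega
  · have h0 := Computes.refl fun ω : (∀ b, A b × R b) × {r // r ∈ (coins μ).support} =>
      BitCode.enc (ω.1 b) ++ ω.2.1
    have hs := h0.left fun _ => BitCode.length_enc _
    have hr := h0.right fun _ => BitCode.length_enc _
    have ho := ((hs.fst.append hr).trans (Computes.of_hasCircuit hF _)).congr fun ω =>
      hFs (ω.1 b).1 ω.2.1 ω.2.2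
    refine ((ho.append hs.snd).congr fun ω => ?_).mono (t := 3 * n + e + BitCode.len (A b) +
      2 * BitCode.len G + BitCode.len (R b) + BitCode.len (R !b) + 1) (by omega)
    simp [hI, BitCode.enc]
  · have h0 := Computes.refl (stateBits (S := fun b => A b × R b) b)
    have hs := h0.left fun _ => BitCode.length_enc _
    have hs' := h0.right fun _ => BitCode.length_enc _
    have hc := (Computes.const (stateBits (S := fun b => A b × R b) b) r).mono
      ((length_of_mem_coins hr).trans_le hsim.coins_le)
    have ho := ((Computes.refl (stateBits (S := fun b => A b × R b) b)).append
      ((hs.fst.append hc).trans (Computes.of_hasCircuit hF _))).congr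
      (h := fun s => stateBits (S := fun b => A b × R b) b s ++
        ((sim (s b).1 r).1 ++ BitCode.enc (sim (s b).1 r).2))
      fun s : ∀ b, A b × R b => by rw [← hFs (s b).1 r hr]
    have hlenS : ∀ s : ∀ b, A b × R b, (stateBits b s).length =
        BitCode.len (A b × R b) + BitCode.len (A (!b) × R (!b)) := fun s => by
      simp [stateBits, BitCode.length_enc]
    have k0 := Computes.refl fun s : ∀ b, A b × R b => stateBits (S := fun b => A b × R b) b s ++
        ((sim (s b).1 r).1 ++ BitCode.enc (sim (s b).1 r).2)
    have k1 := k0.left hlenS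
    have k2 := k0.right hlenS
    have kt := k2.left fun _ => hsim.length_eq _ _
    have ko := k2.right fun _ => hsim.length_eq _ _
    have ks := k1.left fun _ => BitCode.length_enc _
    have ks' := k1.right fun _ => BitCode.length_enc _
    have kf := (((ks.fst.append ks'.fst).append ko).congr
      (h := fun s => stateBits b (fun b => (s b).1) ++ BitCode.enc (sim (s b).1 r).2)
      fun s => by simp [stateBits]).trans
      (hf.reindex fun s : ∀ b, A b × R b => (fun b => (s b).1, (sim (s b).1 r).2))
    have hk := kt.append ((ko.pair ks.snd).append (kf.pair ks'.snd))
    exact ((ho.trans hk).congr fun s => by simp [viewBits, stateBits, hI]).mono (by omega)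
  -- The reduction: `D` reads the experiment of `p`, inserts the states set aside, and applies `d`.
  · obtain ⟨D, hD, hDd⟩ : ∃ D : List Bool → Bool,
        HasCircuit (σ + (3 * n + e + BitCode.len (A b) + 2 * BitCode.len G + BitCode.len (R b) +
          BitCode.len (R !b) + 1)) (fun v => [D v]) ∧
        ∀ ω : {l : List Bool // l.length = p.transcriptLen b} × G × G,
          D (BitCode.enc (s b).1 ++ ω.1.1 ++ BitCode.enc ω.2.1 ++ BitCode.enc ω.2.2) =
            d (fun b' => (if b' = b then ω.2.1 else ω.2.2, (s b').2), ω.1.1) := by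
      have : Nonempty ({l : List Bool // l.length = p.transcriptLen b} × G × G) :=
        ⟨⟨List.replicate _ false, List.length_replicate⟩, 0, 0⟩
      have h0 := Computes.refl fun ω : {l : List Bool // l.length = p.transcriptLen b} × G × G =>
        BitCode.enc (s b).1 ++ (ω.1.1 ++ (BitCode.enc ω.2.1 ++ BitCode.enc ω.2.2))
      have h1 := h0.right fun _ => BitCode.length_enc _
      have h2 := h1.right fun ω => ω.1.2
      have h3 := (((h1.left fun ω => ω.1.2).append
        (((h2.left fun _ => BitCode.length_enc _).append (Computes.enc_const _ (s b).2)).append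
        ((h2.right fun _ => BitCode.length_enc _).append (Computes.enc_const _ (s !b).2)))).congr
        (h := fun ω => viewBits (T := fun b => G × R b) b
          (fun b' => (if b' = b then ω.2.1 else ω.2.2, (s b').2), ω.1.1)) fun ω => by
          simp [viewBits, stateBits, BitCode.enc]).trans
        (hd.reindex fun ω : {l : List Bool // l.length = p.transcriptLen b} × G × G =>
          ⟨(fun b' => (if b' = b then ω.2.1 else ω.2.2, (s b').2), ω.1.1), ω.1.2⟩)
      have e0 : (fun ω : {l : List Bool // l.length = p.transcriptLen b} × G × G =>
          BitCode.enc (s b).1 ++ (ω.1.1 ++ (BitCode.enc ω.2.1 ++ BitCode.enc ω.2.2))) = fun ω =>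
          BitCode.enc (s b).1 ++ ω.1.1 ++ BitCode.enc ω.2.1 ++ BitCode.enc ω.2.2 := by
        funext ω; simp
      rw [e0] at h3
      obtain ⟨D, hD, hDd⟩ := h3.exists_test
        (n := BitCode.len (A b) + p.transcriptLen b + BitCode.len G + BitCode.len G)
        fun ω => by simp [BitCode.length_enc, ω.1.2, add_assoc]
      exact ⟨D, hD.mono (by omega), hDd⟩
    have hadv := hsim.advantage_le _ ε hH D hD fun b => (s b).1
    rw [advantage_eq_abs_prob_sub, real, ideal, prob_map, prob_map] at hadv
    rw [Protocol.view_frame, prob_map, prob_map, Protocol.view, prob_map]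
    refine le_trans (le_of_eq ?_) (hadv.trans (le_mul_of_one_le_left (H.nonneg hH) ?_))
    · congr 2
      · refine prob_congr _ fun r hr => ?_
        have := hDd (⟨r.2 b, p.length_of_mem_run b hr⟩, r.1 b, r.1 !b)
        rw [hite r.1 fun b => (s b).2] at this
        exact this.symm
      · refine prob_congr _ fun r _ => ?_
        exact (hDd (⟨_, hsim.length_eq (s b).1 r⟩, (sim (s b).1 r).2,
          f (fun b => (s b).1) - (sim (s b).1 r).2)).symm
    -- The summand 1 in the cost ensures that the factor in front of `ε` is at least 1.
    · exact_mod_cast (by omega)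

/-! ### Sharing -/

section Uniform

variable {α β γ : Type*} [Fintype α] [Nonempty α] [Fintype β] [Nonempty β] [Fintype γ] [Nonempty γ]

theorem uniform_bind_uniform (e : α → β → γ) (he : Function.Bijective fun p : α × β => e p.1 p.2) :
    ((PMF.uniformOfFintype α).bind fun u => (PMF.uniformOfFintype β).map (e u)) =
      PMF.uniformOfFintype γ := by
  classical
  ext g
  obtain ⟨⟨u₀, v₀⟩, rfl⟩ := he.2 g
  have hc : Fintype.card γ = Fintype.card α * Fintype.card β := by
    rw [← Fintype.card_of_bijective he, Fintype.card_prod]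
  have hiff : ∀ u v, e u₀ v₀ = e u v ↔ u₀ = u ∧ v₀ = v := fun u v =>
    ⟨fun h => by simpa using he.1 (a₁ := (u₀, v₀)) (a₂ := (u, v)) h, by rintro ⟨rfl, rfl⟩; rfl⟩
  simp only [PMF.bind_apply, PMF.map_apply, PMF.uniformOfFintype_apply, tsum_fintype, hiff]
  rw [Finset.sum_eq_single u₀ (fun u _ hu => by simp [hu.symm]) (by simp),
    Finset.sum_eq_single v₀ (fun v _ hv => by simp [hv.symm]) (by simp), hc]
  simp only [and_self, if_true, Nat.cast_mul]
  rw [ENNReal.mul_inv (by simp) (by simp)]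

end Uniform

section Share

variable {N : ℕ} [NeZero N]

/-- The residue that is written on a piece of the random tape. -/
def residueOfBits (N : ℕ) [NeZero N] : List Bool → ZMod N :=
  Function.invFun fun z : ZMod N => natBits (N - 1).size z.val

theorem residueOfBits_natBits (z : ZMod N) :
    residueOfBits N (natBits (N - 1).size z.val) = z := by
  refine Function.leftInverse_invFun (f := fun z : ZMod N => natBits (N - 1).size z.val) ?_ z
  intro x y h
  have hlt : ∀ z : ZMod N, z.val < 2 ^ (N - 1).size := fun z =>
    (Nat.le_sub_one_of_lt z.val_lt).trans_lt (Nat.lt_size_self _)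
  apply ZMod.val_injective N
  apply Nat.eq_of_testBit_eq
  intro i
  by_cases hi : i < (N - 1).size
  · simp only [natBits, List.map_inj_left, List.mem_range] at h
    exact h i hi
  · have hp : 2 ^ (N - 1).size ≤ 2 ^ i := Nat.pow_le_pow_right (by norm_num) (by omega)
    rw [Nat.testBit_lt_two_pow ((hlt x).trans_le hp), Nat.testBit_lt_two_pow ((hlt y).trans_le hp)]

/-- The masks that are written on a random tape, that of party `b` first. -/
def masksOfBits (N : ℕ) [NeZero N] (b : Bool) (r : List Bool) : Bool → ZMod N := fun b' =>
  if b' = b then residueOfBits N (r.take (N - 1).size) else residueOfBits N (r.drop (N - 1).size)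

theorem exists_of_mem_coins {r : List Bool} (h : r ∈ (coins [N - 1, N - 1]).support) :
    ∃ x y : ZMod N, r = natBits (N - 1).size x.val ++ natBits (N - 1).size y.val := by
  have hN : N - 1 + 1 = N := Nat.succ_pred_eq_of_pos (NeZero.pos N)
  simp only [coins, PMF.mem_support_bind_iff, PMF.mem_support_map_iff, PMF.mem_support_pure_iff] at h
  obtain ⟨u, -, -, ⟨v, -, -, rfl, rfl⟩, rfl⟩ := h
  exact ⟨(u : ℕ), (v : ℕ), by
    rw [ZMod.val_natCast_of_lt (by omega), ZMod.val_natCast_of_lt (by omega), List.append_nil]⟩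

theorem masksOfBits_append (b : Bool) (x y : ZMod N) :
    masksOfBits N b (natBits (N - 1).size x.val ++ natBits (N - 1).size y.val) =
      fun b' => if b' = b then x else y := by
  funext b'
  simp only [masksOfBits, List.take_left' (length_natBits _ _),
    List.drop_left' (length_natBits _ _), residueOfBits_natBits]

/-- Two uniform samples of `{0, …, N - 1}` reproduce the dealt masks exactly, without statistical
error. -/
theorem map_masksOfBits (b : Bool) :
    (coins [N - 1, N - 1]).map (masksOfBits N b) = PMF.uniformOfFintype (Bool → ZMod N) := by
  have hN : N - 1 + 1 = N := Nat.succ_pred_eq_of_pos (NeZero.pos N)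
  have hval : ∀ u : Fin (N - 1 + 1), ((u : ℕ) : ZMod N).val = u := fun u =>
    ZMod.val_natCast_of_lt (by omega)
  rw [← uniform_bind_uniform (α := Fin (N - 1 + 1)) (β := Fin (N - 1 + 1))
    fun u v b' => if b' = b then ((u : ℕ) : ZMod N) else ((v : ℕ) : ZMod N)]
  · simp only [coins, PMF.pure_map, List.append_nil, PMF.map_bind]
    congr 1
    funext u
    rw [← PMF.bind_pure_comp]
    congr 1
    funext v
    have h := masksOfBits_append b ((u : ℕ) : ZMod N) ((v : ℕ) : ZMod N)
    rw [hval, hval] at h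
    exact congrArg PMF.pure h
  · constructor
    · rintro ⟨u, v⟩ ⟨u', v'⟩ h
      have h1 := congrArg ZMod.val (congrFun h b)
      have h2 := congrArg ZMod.val (congrFun h !b)
      simp only [hval, if_true, Bool.not_eq_self, if_false] at h1 h2
      exact Prod.ext (Fin.ext h1) (Fin.ext h2)
    · intro ρ
      refine ⟨(⟨(ρ b).val, by rw [hN]; exact ZMod.val_lt _⟩,
        ⟨(ρ !b).val, by rw [hN]; exact ZMod.val_lt _⟩), funext fun b' => ?_⟩
      cases b <;> cases b' <;> simp

end Share
-- Perfect simulation of the sharing step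
section Share

variable {k m N : ℕ} [NeZero N]

theorem Computes.natBits_extend {Ω : Type} {s v w : ℕ} {f : Ω → List Bool} {x : Ω → ℕ}
    (h : Computes s f fun ω => natBits v (x ω)) (hx : ∀ ω, x ω < 2 ^ v) (hvw : v ≤ w) :
    Computes (s + (w - v)) f fun ω => natBits w (x ω) := by
  have key : ∀ n, Computes (s + n) f fun ω => natBits (v + n) (x ω) := by
    intro n
    induction n with
    | zero => exact h
    | succ n ih =>
      refine (ih.append (bit f false)).congr fun ω => ?_
      rw [← add_assoc, natBits_succ', Nat.testBit_lt_two_pow]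
      exact (hx ω).trans_le (Nat.pow_le_pow_right (by norm_num) (by omega))
  have := key (w - v)
  rwa [Nat.add_sub_cancel' hvw] at this

theorem Computes.maskOfBits {Ω : Type} {s : ℕ} {f : Ω → List Bool} {r : Ω → List Bool}
    (h : Computes s f r) (hr : ∀ ω, r ω ∈ (coins [N - 1, N - 1]).support) (b b' : Bool) :
    Computes (s + N.size) f fun ω => BitCode.enc (masksOfBits N b (r ω) b') := by
  -- A tape piece has `(N - 1).size` digits and an encoded residue `N.size`; these differ when `N`
  -- is a power of two, and then a zero digit is appended.
  have hsize : (N - 1).size ≤ N.size := Nat.size_le_size (Nat.sub_le _ _)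
  have hlt : ∀ z : ZMod N, z.val < 2 ^ (N - 1).size := fun z =>
    (Nat.le_sub_one_of_lt z.val_lt).trans_lt (Nat.lt_size_self _)
  have h' : Computes s f fun ω => natBits (N - 1).size (masksOfBits N b (r ω) b').val := by
    by_cases hb : b' = b
    · refine (h.take (N - 1).size).congr fun ω => ?_
      obtain ⟨x, y, e⟩ := exists_of_mem_coins (hr ω)
      simp only [e, masksOfBits_append, List.take_left' (length_natBits _ _), if_pos hb]
    · refine (h.drop (N - 1).size).congr fun ω => ?_
      obtain ⟨x, y, e⟩ := exists_of_mem_coins (hr ω)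
      simp only [e, masksOfBits_append, List.drop_left' (length_natBits _ _), if_neg hb]
  exact (h'.natBits_extend (fun ω => hlt _) hsize).mono (by omega)

theorem Computes.ownValue {Ω : Type} {s : ℕ} {f : Ω → List Bool} (i : Fin k) (j a : Fin m)
    (b : Bool) {x : Ω → MatIn k m N b} (h : Computes s f fun ω => BitCode.enc (x ω)) :
    Computes s f fun ω => BitCode.enc (ownValue i j a b (x ω)) := by
  cases b
  · exact h.matrix_entry (M := fun ω => (x ω : Matrix (Fin k) (Fin m) (ZMod N))) i a
  · exact h.matrix_entry (M := fun ω => (x ω : Matrix (Fin m) (Fin m) (ZMod N))) a j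

theorem Computes.sharesHeld {Ω : Type} {s t u : ℕ} {f : Ω → List Bool} {v r r' : Ω → ZMod N}
    (hv : Computes s f fun ω => BitCode.enc (v ω)) (hr : Computes t f fun ω => BitCode.enc (r ω))
    (hr' : Computes u f fun ω => BitCode.enc (r' ω)) (b : Bool) :
    Computes (2 * s + 2 * t + u + 300 * (N.size + 1)) f
      fun ω => BitCode.enc (sharesHeld (v ω) (r ω) (r' ω) b) := by
  cases b
  · exact ((hv.zmod_sub hr).pair hr').mono (by omega)
  · exact (hr'.pair (hv.zmod_sub hr)).mono (by omega)

/-- The sharing of the operands of the product `x i a * y a j`. -/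
def share (i : Fin k) (j a : Fin m) :
    Protocol (MatState k m N) (fun b => SharePair N b × MatState k m N b) :=
  .seq (.seq (.deal (fun _ => ZMod N) (PMF.uniformOfFintype (Bool → ZMod N)))
    (.exchange (fun _ => ZMod N) fun _ s => s.2))
  (.compute fun b s => (sharesHeld (ownValue i j a b s.1.1.1) s.1.2 s.2 b, s.1.1))

theorem view_share (i : Fin k) (j a : Fin m) (b : Bool) (s : ∀ b, MatState k m N b) :
    (share i j a).view b s = (PMF.uniformOfFintype (Bool → ZMod N)).map fun ρ =>
      (fun b' => (sharesHeld (ownValue i j a b' (s b').1) (ρ b') (ρ !b') b', s b'),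
        BitCode.enc (ρ b) ++ BitCode.enc (ρ !b)) := by
  simp only [share, Protocol.view_seq, Protocol.view_compute]
  simp only [Protocol.view, Protocol.run, PMF.map_comp, PMF.pure_map, PMF.bind_map]
  rw [← PMF.bind_pure_comp]
  simp [Function.comp_def]

/-- Party `b` sees only its own mask and the received mask, both uniform and independent of the
inputs. Dealing and exchanging are treated as one block, since a received message cannot in general
be computed from the receiver's state alone. -/
theorem simulatable_share (H : AdvantageBound) (b : Bool) (i : Fin k) (j a : Fin m) :
    Simulatable H b (share (N := N) i j a)
      (fun s t => ((t false).1.1 + (t true).1.1 = ownValue i j a false (s false).1 ∧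
        (t false).1.2 + (t true).1.2 = ownValue i j a true (s true).1) ∧ ∀ b, (t b).2 = s b)
      (1000 * (N.size + 1)) := by
  have hsize : (N - 1).size ≤ N.size := Nat.size_le_size (Nat.sub_le _ _)
  have hlen : (share (N := N) i j a).transcriptLen b = N.size + N.size := by
    simp [share, Protocol.transcriptLen, BitCode.len]
  refine ⟨[N - 1, N - 1], fun s r =>
    (fun b' => (sharesHeld (ownValue i j a b' (s b').1) (masksOfBits N b r b')
      (masksOfBits N b r !b') b', s b'),
      BitCode.enc (masksOfBits N b r b) ++ BitCode.enc (masksOfBits N b r !b)),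
    fun s s' r h => ?_, fun s s' r h => ?_, fun s r => ?_,
    fun s r => ⟨⟨?_, ?_⟩, fun _ => rfl⟩, ?_, ?_, ?_, fun r hr => ?_, fun σ ε hH d hd s => ?_⟩
  · simp [h]
  · rfl
  · rw [hlen]; simp [BitCode.length_enc]; rfl
  · simp [sharesHeld]
  · simp [sharesHeld]
  · rw [hlen]; omega
  · simp; omega
  · have h0 := Computes.refl
      fun ω : (∀ b, MatState k m N b) × {r // r ∈ (coins [N - 1, N - 1]).support} =>
        BitCode.enc (ω.1 b) ++ ω.2.1
    have hs := h0.left fun _ => BitCode.length_enc _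
    have hr := h0.right fun _ => BitCode.length_enc _
    have hm := hr.maskOfBits (fun ω => ω.2.2) b
    exact (((hm b).append (hm !b)).append
      (((hs.fst.ownValue i j a b).sharesHeld (hm b) (hm !b) b).pair hs)).mono (by omega)
  · have h0 := Computes.refl (stateBits (S := MatState k m N) b)
    have hs := h0.left fun _ => BitCode.length_enc _
    have hs' := h0.right fun _ => BitCode.length_enc _
    have hm : ∀ b', Computes N.size (stateBits (S := MatState k m N) b)
        fun _ => BitCode.enc (masksOfBits N b r b') := fun b' =>
      Computes.enc_const _ (masksOfBits N b r b')
    exact (((hm b).append (hm !b)).append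
      ((((hs.fst.ownValue i j a b).sharesHeld (hm b) (hm !b) b).pair hs).append
        (((hs'.fst.ownValue i j a !b).sharesHeld (hm !b) (hm !!b) !b).pair hs'))).mono (by omega)
  · rw [view_share, ← map_masksOfBits b, PMF.map_comp]
    rw [show ∀ P Q : PMF _, P = Q → |prob P d - prob Q d| = 0 from fun P Q h => by simp [h]]
    · exact mul_nonneg (Nat.cast_nonneg _) (H.nonneg hH)
    · rfl

end Share

/-! ### The inner loop -/

section Accumulates

variable {k m N : ℕ}

/-- The inputs are unchanged and the shared matrix grows by `g`. -/
def Accumulates (g : (∀ b, MatIn k m N b) → Matrix (Fin k) (Fin m) (ZMod N))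
    (s t : ∀ b, MatState k m N b) : Prop :=
  (∀ b, (t b).1 = (s b).1) ∧
    (t false).2 + (t true).2 = (s false).2 + (s true).2 + g fun b => (s b).1

theorem accumulates_zero (s : ∀ b, MatState k m N b) : Accumulates 0 s s :=
  ⟨fun _ => rfl, by simp⟩

theorem accumulates_add (g g' : (∀ b, MatIn k m N b) → Matrix (Fin k) (Fin m) (ZMod N))
    (s t u : ∀ b, MatState k m N b) (h : Accumulates g s t) (h' : Accumulates g' t u) :
    Accumulates (g + g') s u :=
  ⟨fun b => (h'.1 b).trans (h.1 b), by
    rw [h'.2, h.2, funext h.1, Pi.add_apply, add_assoc]⟩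

/-- The product `x i a * y a j` at the position `(i, j)`. -/
def summand (i : Fin k) (j a : Fin m) (x : ∀ b, MatIn k m N b) : Matrix (Fin k) (Fin m) (ZMod N) :=
  Matrix.single i j (ownValue i j a false (x false) * ownValue i j a true (x true))

theorem updateRow_update_add_updateRow_update (M M' : Matrix (Fin k) (Fin m) (ZMod N)) (i : Fin k)
    (j : Fin m) {x x' c : ZMod N} (h : x + x' = c + (M i j + M' i j)) :
    M.updateRow i (Function.update (M i) j x) + M'.updateRow i (Function.update (M' i) j x') =
      M + M' + Matrix.single i j c := by
  ext i' j'
  simp only [Matrix.add_apply, Matrix.updateRow_apply, Matrix.single_apply]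
  by_cases hi : i' = i
  · subst hi
    by_cases hj : j' = j
    · subst hj
      simp [h, add_comm]
    · simp [hj, Ne.symm hj]
  · simp [hi, Ne.symm hi]

theorem sum_filter_map {ι G : Type*} [AddCommMonoid G] (q : ι → Prop) [DecidablePred q] (f : ι → G)
    (L : List ι) : ((L.filter fun a => q a).map f).sum = (L.map fun a => if q a then f a else 0).sum := by
  induction L with
  | nil => rfl
  | cons a L ih => by_cases h : q a <;> simp [h, ih]

/-- The products left out of the bins have a factor `y a j` with `(a, j) ∉ l`, which is zero. -/
theorem sum_summand {l : Finset (Fin m × Fin m)} {x : ∀ b, MatIn k m N b} (hx : x ∈ supportedIn l) :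
    ((List.finRange k).map fun i => ((List.finRange m).map fun j =>
      ((bin l j).map (summand i j)).sum).sum).sum x = matProd x := by
  have hev : ∀ L : List ((∀ b, MatIn k m N b) → Matrix (Fin k) (Fin m) (ZMod N)),
      L.sum x = (L.map fun g => g x).sum := fun L =>
    map_list_sum (Pi.evalAddMonoidHom (fun _ => Matrix (Fin k) (Fin m) (ZMod N)) x) L
  simp only [hev, List.map_map, Function.comp_def, bin, sum_filter_map, ← Fin.sum_univ_def,
    Finset.sum_apply, ite_apply, Pi.zero_apply]
  conv_rhs => rw [Matrix.matrix_eq_sum_single (matProd x)]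
  refine Finset.sum_congr rfl fun i _ => Finset.sum_congr rfl fun j _ => ?_
  rw [matProd, Matrix.mul_apply, ← Matrix.singleAddMonoidHom_apply, map_sum]
  refine Finset.sum_congr rfl fun a _ => ?_
  split_ifs with h
  · rfl
  · rw [hx a j h]; simp

/-- Puts the corrupted party first, in the order used by `stateBits b`. -/
theorem sumOfShared_eq (b : Bool) (s : ∀ b, SharePair N b) :
    sumOfShared s = ((s b).1 + (s !b).1) + ((s b).2 + (s !b).2) := by
  cases b
  · rfl
  · exact congrArg₂ _ (add_comm _ _) (add_comm _ _)

theorem prodOfShared_eq (b : Bool) (s : ∀ b, SharePair N b) :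
    prodOfShared s = ((s b).1 + (s !b).1) * ((s b).2 + (s !b).2) := by
  cases b
  · rfl
  · exact congrArg₂ _ (add_comm _ _) (add_comm _ _)

end Accumulates

/-! ### Assembling the simulation of the whole protocol -/

section InnerLoop

variable {N : ℕ} [NeZero N]

theorem computes_sumOfShared_sub (b : Bool) :
    Computes (20000 * (N.size + 1) ^ 2)
      (fun ω : (∀ b, SharePair N b) × ZMod N => stateBits b ω.1 ++ BitCode.enc ω.2)
      fun ω => BitCode.enc (sumOfShared ω.1 - ω.2) := by
  have h0 := Computes.refl
    fun ω : (∀ b, SharePair N b) × ZMod N => stateBits b ω.1 ++ BitCode.enc ω.2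
  have hn : ∀ ω : (∀ b, SharePair N b) × ZMod N, (stateBits b ω.1).length =
    BitCode.len (ZMod N × ZMod N) + BitCode.len (ZMod N × ZMod N) := fun ω => by
    simp [stateBits, BitCode.length_enc]
  have ho := h0.right hn
  have hs := (h0.left hn).left fun _ => BitCode.length_enc _
  have hs' := (h0.left hn).right fun _ => BitCode.length_enc _
  exact ((((hs.fst.zmod_add hs'.fst).zmod_add (hs.snd.zmod_add hs'.snd)).zmod_sub ho).congr
    fun ω => by rw [sumOfShared_eq b]).mono (by ring_nf; omega)

theorem computes_prodOfShared_sub (b : Bool) :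
    Computes (20000 * (N.size + 1) ^ 2)
      (fun ω : (∀ b, SharePair N b) × ZMod N => stateBits b ω.1 ++ BitCode.enc ω.2)
      fun ω => BitCode.enc (prodOfShared ω.1 - ω.2) := by
  have h0 := Computes.refl
    fun ω : (∀ b, SharePair N b) × ZMod N => stateBits b ω.1 ++ BitCode.enc ω.2
  have hn : ∀ ω : (∀ b, SharePair N b) × ZMod N, (stateBits b ω.1).length =
    BitCode.len (ZMod N × ZMod N) + BitCode.len (ZMod N × ZMod N) := fun ω => by
    simp [stateBits, BitCode.length_enc]
  have ho := h0.right hn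
  have hs := (h0.left hn).left fun _ => BitCode.length_enc _
  have hs' := (h0.left hn).right fun _ => BitCode.length_enc _
  exact ((((hs.fst.zmod_add hs'.fst).zmod_mul (hs.snd.zmod_add hs'.snd)).zmod_sub ho).congr
    fun ω => by rw [prodOfShared_eq b]).mono (by ring_nf; omega)

variable {k m : ℕ}

theorem len_matState (k m N : ℕ) [NeZero N] (b : Bool) :
    BitCode.len (MatState k m N b) ≤ (2 * k + m) * m * N.size := by
  cases b <;> simp only [BitCode.len] <;> ring_nf <;> omega

/-- The circuit size for one pass through the inner loop, where `n` is the size for `Add` and `Mul`. -/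
def innerCost (k m N n : ℕ) : ℕ :=
  6 * n + 50000 * (N.size + 1) ^ 2 + 4 * ((2 * k + m) * m * N.size)

theorem simulatable_innerStep {H : AdvantageBound} {b : Bool}
    {add mul : Protocol (SharePair N) fun _ => ZMod N} {n : ℕ} {μ ν : List ℕ}
    {simAdd simMul : SharePair N b → List Bool → List Bool × ZMod N}
    (hadd : IsSimulator H b add sumOfShared n μ simAdd)
    (hmul : IsSimulator H b mul prodOfShared n ν simMul) (i : Fin k) (j a : Fin m) :
    Simulatable H b (innerStep add mul i j a) (Accumulates (summand i j a)) (innerCost k m N n) := by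
  have h1 := simulatable_share (N := N) H b i j a
  have h2 := hmul.simulatable_frame (computes_prodOfShared_sub b) (MatState k m N)
  have h3 : Simulatable H b (.compute (S := fun b => ZMod N × MatState k m N b)
    (T := fun b => SharePair N b × MatState k m N b)
    fun _ s => ((s.1, s.2.2 i j), s.2)) _ (2 * 0) := Simulatable.compute H _ fun b' => by
      have h0 := Computes.refl fun s : ZMod N × MatState k m N b' => BitCode.enc s
      exact (h0.fst.pair (h0.snd.snd.matrix_entry i j)).pair h0.snd
  have h4 := hadd.simulatable_frame (computes_sumOfShared_sub b) (MatState k m N)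
  have h5 : Simulatable H b (.compute (S := fun b => ZMod N × MatState k m N b)
    (T := MatState k m N)
    fun _ s => (s.2.1, s.2.2.updateRow i (Function.update (s.2.2 i) j s.1))) _ (2 * 0) :=
    Simulatable.compute H _ fun b' => by
      have h0 := Computes.refl fun s : ZMod N × MatState k m N b' => BitCode.enc s
      exact h0.snd.fst.pair (h0.snd.snd.matrix_update h0.fst i j)
  have hseq := (h1.seq (h2.seq (h3.seq (h4.seq h5)))).seq_assoc.seq_assoc
  refine Simulatable.mono hseq ?_ ?_
  -- Each of the two framed calls costs `3 * n`, one circuit for `f - o`, and the states set aside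
  -- by both parties; the remaining terms are absorbed in the constant 50000.
  · have hl := len_matState k m N b
    have hl' := len_matState k m N !b
    have hz : BitCode.len (ZMod N) = N.size := rfl
    have hp : BitCode.len (SharePair N b) = N.size + N.size := rfl
    rw [innerCost, hz, hp]
    have hq : (N.size + 1) ≤ (N.size + 1) ^ 2 := Nat.le_self_pow (by norm_num) _
    omega
  · rintro s t₅ ⟨t₁, ⟨⟨ha, hb⟩, hc⟩, t₂, ⟨hd, he⟩, t₃, hf, t₄, ⟨hg, hh⟩, hi⟩
    simp only [hf, he, hc, hd, prodOfShared, sumOfShared, ha, hb] at hd hg hh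
    refine ⟨fun b => by simp [hi, hh], ?_⟩
    simp only [hi, hh]
    exact updateRow_update_add_updateRow_update _ _ i j hg

theorem simulatable_matrixMul {H : AdvantageBound} {b : Bool}
    {add mul : Protocol (SharePair N) fun _ => ZMod N} {n : ℕ} {μ ν : List ℕ}
    {simAdd simMul : SharePair N b → List Bool → List Bool × ZMod N}
    (hadd : IsSimulator H b add sumOfShared n μ simAdd)
    (hmul : IsSimulator H b mul prodOfShared n ν simMul) (l : Finset (Fin m × Fin m)) :
    Simulatable H b (matrixMul (k := k) add mul l)
      (fun x z => x ∈ supportedIn l → z false + z true = matProd x)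
      (k * (m * (m * innerCost k m N n)) + 2 * (k * (m * N.size))) := by
  have h1 : Simulatable H b (.compute (S := MatIn k m N) (T := MatState k m N) fun _ x => (x, 0)) _
      (2 * (k * (m * N.size))) := Simulatable.compute H _ fun b' => by
    have h0 := Computes.refl fun x : MatIn k m N b' => BitCode.enc x
    exact (h0.pair (Computes.enc_const _ (0 : Matrix (Fin k) (Fin m) (ZMod N)))).mono
      (by simp [BitCode.len])
  have h2 := Simulatable.forEach (n := k) accumulates_zero accumulates_add
    (fun i => Simulatable.forEach (n := m) accumulates_zero accumulates_add
      (fun j => Simulatable.forEach (n := m) accumulates_zero accumulates_add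
        (fun a => simulatable_innerStep hadd hmul i j a)
        (L := bin l j) ((List.length_filter_le _ _).trans_eq (List.length_finRange)))
      (List.length_finRange (n := m)).le) (List.length_finRange (n := k)).le
  have h3 : Simulatable H b (.compute (S := MatState k m N)
      (T := fun _ => Matrix (Fin k) (Fin m) (ZMod N)) fun _ s => s.2) _ (2 * 0) :=
    Simulatable.compute H _ fun b' =>
      (Computes.refl fun s : MatState k m N b' => BitCode.enc s).snd
  refine Simulatable.mono (h1.seq (h2.seq h3)) (by omega) ?_
  rintro x z ⟨s, hs, t, ⟨ht, ht'⟩, hz⟩ hx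
  simp only [hz, ht', hs]
  simpa using sum_summand hx

end InnerLoop
/-! ### Polynomially bounded functions and uniform bounds -/

namespace PolyBounded

variable {s t : ℕ → ℕ}

theorem mono (h : PolyBounded t) (hst : ∀ κ, s κ ≤ t κ) : PolyBounded s := by
  obtain ⟨p, hp⟩ := h
  exact ⟨p, fun κ => (hst κ).trans (hp κ)⟩

theorem const (c : ℕ) : PolyBounded fun _ => c := ⟨.C c, fun κ => by simp⟩

theorem add (hs : PolyBounded s) (ht : PolyBounded t) : PolyBounded fun κ => s κ + t κ := by
  obtain ⟨p, hp⟩ := hs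
  obtain ⟨q, hq⟩ := ht
  exact ⟨p + q, fun κ => by rw [Polynomial.eval_add]; exact add_le_add (hp κ) (hq κ)⟩

theorem mul (hs : PolyBounded s) (ht : PolyBounded t) : PolyBounded fun κ => s κ * t κ := by
  obtain ⟨p, hp⟩ := hs
  obtain ⟨q, hq⟩ := ht
  exact ⟨p * q, fun κ => by rw [Polynomial.eval_mul]; exact Nat.mul_le_mul (hp κ) (hq κ)⟩

end PolyBounded

theorem Negligible.of_le_mul {ε δ : ℕ → ℝ} {c : ℕ → ℕ} (hε : Negligible ε) (hc : PolyBounded c)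
    (h0 : ∀ κ, 0 ≤ δ κ) (h : ∀ κ, δ κ ≤ c κ * ε κ) : Negligible δ := by
  obtain ⟨p, hp⟩ := hc
  refine (hε.polynomial_mul (p.map (Nat.castRingHom ℝ))).trans_abs_le fun κ => ?_
  have he : (p.map (Nat.castRingHom ℝ)).eval (κ : ℝ) = (p.eval κ : ℕ) := by
    rw [Polynomial.eval_natCast_map]; rfl
  simp only [he, abs_mul, Nat.abs_cast, abs_of_nonneg (h0 κ)]
  calc δ κ ≤ c κ * ε κ := h κ
    _ ≤ c κ * |ε κ| := mul_le_mul_of_nonneg_left (le_abs_self _) (Nat.cast_nonneg _)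
    _ ≤ _ := mul_le_mul_of_nonneg_right (by exact_mod_cast hp κ) (abs_nonneg _)

/-- The supremum may not be attained, but some value exceeds half of it unless it is zero. -/
theorem exists_forall_le_two_mul {ι : Type*} [Nonempty ι] {a : ι → ℝ} (ha : ∀ i, 0 ≤ a i)
    (hb : ∀ i, a i ≤ 1) : ∃ i, ∀ j, a j ≤ 2 * a i := by
  have hbdd : BddAbove (Set.range a) := ⟨1, by rintro _ ⟨i, rfl⟩; exact hb i⟩
  rcases (Real.iSup_nonneg ha).eq_or_lt with h | h
  · obtain ⟨i⟩ := ‹Nonempty ι›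
    exact ⟨i, fun j => by have := le_ciSup hbdd j; have := ha i; linarith⟩
  · obtain ⟨i, hi⟩ := exists_lt_of_lt_ciSup (half_lt_self h)
    exact ⟨i, fun j => by have := le_ciSup hbdd j; linarith⟩

theorem advantage_le_one (D : List Bool → Bool) (P Q : PMF (List Bool)) : advantage D P Q ≤ 1 := by
  rw [advantage_eq_abs_prob_sub, abs_le]
  constructor <;>
    linarith [prob_nonneg P D, prob_nonneg Q D, prob_le_one P D, prob_le_one Q D]

/-- Negligible advantage on all sequences of inputs is a bound that is uniform in the inputs and in
the distinguishers of a given size. -/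
theorem exists_negligible_bound {X : ℕ → Type} [∀ κ, Nonempty (X κ)]
    {P Q : ∀ κ, X κ → PMF (List Bool)}
    (h : ∀ (D : ℕ → List Bool → Bool) (s : ℕ → ℕ), PolyBounded s →
      (∀ κ, HasCircuit (s κ) fun v => [D κ v]) → ∀ x : ∀ κ, X κ,
        Negligible fun κ => advantage (D κ) (P κ (x κ)) (Q κ (x κ)))
    {s : ℕ → ℕ} (hs : PolyBounded s) :
    ∃ ε : ℕ → ℝ, Negligible ε ∧ ∀ κ, 0 ≤ ε κ ∧ ∀ D, HasCircuit (s κ) (fun v => [D v]) → ∀ x,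
      advantage D (P κ x) (Q κ x) ≤ ε κ := by
  have hne : ∀ n, HasCircuit (n + 2) fun _ => [false] := fun n =>
    ⟨[fun _ => false], [fun _ => false], .const _ false .nil, by simp, by simp, by simp⟩
  have key : ∀ κ, ∃ y : {D : List Bool → Bool // HasCircuit (s κ + 2) fun v => [D v]} × X κ,
      ∀ y' : {D : List Bool → Bool // HasCircuit (s κ + 2) fun v => [D v]} × X κ,
        advantage y'.1.1 (P κ y'.2) (Q κ y'.2) ≤ 2 * advantage y.1.1 (P κ y.2) (Q κ y.2) := by
    intro κ
    have : Nonempty {D : List Bool → Bool // HasCircuit (s κ + 2) fun v => [D v]} :=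
      ⟨⟨fun _ => false, hne _⟩⟩
    exact exists_forall_le_two_mul (fun _ => abs_nonneg _) fun _ => advantage_le_one _ _ _
  choose y hy using key
  refine ⟨fun κ => 2 * advantage (y κ).1.1 (P κ (y κ).2) (Q κ (y κ).2), ?_, fun κ =>
    ⟨mul_nonneg zero_le_two (abs_nonneg _), fun D hD x => hy κ (⟨D, hD.mono (by omega)⟩, x)⟩⟩
  -- The nearly optimal distinguishers and inputs, one pair for each `κ`, form a single nonuniform
  -- attack to which the hypothesis applies. The sizes are increased by 2 so that a constant test is
  -- always available.
  exact (h (fun κ => (y κ).1.1) (fun κ => s κ + 2) (hs.add (.const 2)) (fun κ => (y κ).1.2)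
    fun κ => (y κ).2).const_mul 2

/-- Bounds on the advantage of distinguishers between the members of two pairs of families. -/
def AdvantageBound.ofPairs {X : Type} (P Q P' Q' : X → PMF (List Bool)) : AdvantageBound where
  holds σ ε := 0 ≤ ε ∧ ∀ D, HasCircuit σ (fun v => [D v]) → ∀ x,
    advantage D (P x) (Q x) ≤ ε ∧ advantage D (P' x) (Q' x) ≤ ε
  nonneg h := h.1
  anti hσ h := ⟨h.1, fun D hD => h.2 D (HasCircuit.mono (F := fun v => [D v]) hD hσ)⟩

/-- Security does not bound the transcript length explicitly; the bound follows because a small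
simulator has to write the transcript. -/
theorem HasCircuit.length_le {s : ℕ} {F : List Bool → List Bool} (h : HasCircuit s F)
    (v : List Bool) : (F v).length ≤ s := by
  obtain ⟨L, outs, -, -, h3, h4⟩ := h
  rw [h4, List.length_map]
  omega

/-- The actual simulator fills in `z` for the unknown input of the other party; by locality this
does not affect its output. The honest share produced by `I` on the true inputs is the one handed
out by the functionality, because the simulated shares sum to `f x`. -/
theorem IsSimulation.advantage_le {A : Bool → Type} [∀ b, BitCode (A b)] {G : Type} [BitCode G]
    [AddCommGroup G] {H : AdvantageBound} {b : Bool} {p : Protocol A fun _ => G}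
    {dom : Set (∀ b, A b)} {f : (∀ b, A b) → G} {c : ℕ} {μ : List ℕ}
    {I : (∀ b, A b) → List Bool → (Bool → G) × List Bool}
    (h : IsSimulation (T := fun _ => G) H b p
      (fun x z => x ∈ dom → z false + z true = f x) c μ I) {σ : ℕ} {ε : ℝ} {z : ∀ b, A b}
    (hε : H.holds (BitCode.len (A b) + σ + c) ε) {D : List Bool → Bool}
    (hD : HasCircuit σ fun v => [D v]) {x : ∀ b, A b} (hx : x ∈ dom) :
    advantage D (real p x b) (ideal b μ
      (fun a r => ((I (Function.update z b a) r).2, (I (Function.update z b a) r).1 b)) x (f x)) ≤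
      c * ε := by
  set d : (Bool → G) × List Bool → Bool := fun r =>
    D (BitCode.enc (x b) ++ r.2 ++ BitCode.enc (r.1 b) ++ BitCode.enc (r.1 !b)) with hd
  have hdc : HasTestCircuit (T := fun _ => G) b (p.transcriptLen b) (BitCode.len (A b) + σ) d := by
    refine ((Computes.enc_const _ (x b)).append (Computes.refl _)).trans ?_
    refine (Computes.of_hasCircuit hD _).congr fun r => ?_
    simp [hd, viewBits, stateBits]
  have hI := h.indist _ ε hε d hdc x
  rw [prob_map, Protocol.view, prob_map] at hI
  rw [advantage_eq_abs_prob_sub, real, ideal, prob_map, prob_map]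
  convert hI using 5 with r
  have hb : Function.update z b (x b) b = x b := Function.update_self _ _ _
  have hsum : f x - (I x r).1 b = (I x r).1 !b := by
    rw [← h.rel x r hx]
    cases b <;> simp
  rw [h.local_left _ _ r hb, h.local_right _ _ r hb, hsum]

/-- `MatrixMul` is secure if `Add` and `Mul` are. -/
theorem semiHonestSecure_matrixMul (k m N : ℕ → ℕ) [∀ κ, NeZero (N κ)]
    (hk : PolyBounded k) (hm : PolyBounded m)
    (hN : PolyBounded fun κ => (N κ).size)
    (l : ∀ κ, Finset (Fin (m κ) × Fin (m κ)))
    (add mul : ∀ κ, Protocol (SharePair (N κ)) (fun _ => ZMod (N κ)))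
    (hadd : SemiHonestSecure add (fun _ => Set.univ) (fun _ => sumOfShared))
    (hmul : SemiHonestSecure mul (fun _ => Set.univ) (fun _ => prodOfShared)) :
    SemiHonestSecure
      (fun κ => matrixMul (k := k κ) (add κ) (mul κ) (l κ))
      (fun κ => supportedIn (l κ)) (fun _ => matProd) := by
  intro b
  obtain ⟨μ, simAdd, hlen, hμ, ⟨s, hs, hF⟩, hadv⟩ := hadd b
  obtain ⟨ν, simMul, hlen', hν, ⟨s', hs', hF'⟩, hadv'⟩ := hmul b
  set n : ℕ → ℕ := fun κ => s κ + s' κ + ((μ κ).map Nat.size).sum + ((ν κ).map Nat.size).sum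
    with hn
  have hnp : PolyBounded n := ((hs.add hs').add hμ).add hν
  -- Keeping sizes and bounds as a relation lets the simulator be chosen before the distinguisher
  -- and its size are known.
  set H : ℕ → AdvantageBound := fun κ => .ofPairs
    (fun x : ∀ b, SharePair (N κ) b => real (add κ) x b)
    (fun x => ideal b (μ κ) (simAdd κ) x (sumOfShared x))
    (fun x => real (mul κ) x b)
    (fun x => ideal b (ν κ) (simMul κ) x (prodOfShared x)) with hH
  have hsimAdd : ∀ κ, IsSimulator (H κ) b (add κ) sumOfShared (n κ) (μ κ) (simAdd κ) := by
    intro κ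
    obtain ⟨F, hFc, hFs⟩ := hF κ
    refine ⟨hlen κ, ?_, by simp only [hn]; omega,
      ⟨F, hFc.mono (by simp only [hn]; omega), hFs⟩, fun σ ε h D hD x => (h.2 D hD x).1⟩
    obtain ⟨r, hr⟩ := (coins (μ κ)).support_nonempty
    have := hFc.length_le (BitCode.enc (0 : SharePair (N κ) b) ++ r)
    rw [hFs 0 r hr, List.length_append, hlen κ] at this
    simp only [hn]; omega
  have hsimMul : ∀ κ, IsSimulator (H κ) b (mul κ) prodOfShared (n κ) (ν κ) (simMul κ) := by
    intro κ
    obtain ⟨F, hFc, hFs⟩ := hF' κ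
    refine ⟨hlen' κ, ?_, by simp only [hn]; omega,
      ⟨F, hFc.mono (by simp only [hn]; omega), hFs⟩, fun σ ε h D hD x => (h.2 D hD x).2⟩
    obtain ⟨r, hr⟩ := (coins (ν κ)).support_nonempty
    have := hFc.length_le (BitCode.enc (0 : SharePair (N κ) b) ++ r)
    rw [hFs 0 r hr, List.length_append, hlen' κ] at this
    simp only [hn]; omega
  set c : ℕ → ℕ := fun κ => k κ * (m κ * (m κ * innerCost (k κ) (m κ) (N κ) (n κ))) +
    2 * (k κ * (m κ * (N κ).size)) with hc
  have hinner : PolyBounded fun κ => innerCost (k κ) (m κ) (N κ) (n κ) := by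
    simp only [innerCost, pow_two]
    exact (((PolyBounded.const 6).mul hnp).add ((PolyBounded.const 50000).mul
      ((hN.add (.const 1)).mul (hN.add (.const 1))))).add ((PolyBounded.const 4).mul
      (((((PolyBounded.const 2).mul hk).add hm).mul hm).mul hN))
  have hcp : PolyBounded c :=
    (hk.mul (hm.mul (hm.mul hinner))).add ((PolyBounded.const 2).mul (hk.mul (hm.mul hN)))
  choose τ I hI using fun κ =>
    simulatable_matrixMul (k := k κ) (m := m κ) (hsimAdd κ) (hsimMul κ) (l κ)
  set z : ∀ κ b, MatIn (k κ) (m κ) (N κ) b := fun κ b => match b with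
    | false => (0 : Matrix (Fin (k κ)) (Fin (m κ)) (ZMod (N κ)))
    | true => (0 : Matrix (Fin (m κ)) (Fin (m κ)) (ZMod (N κ)))
  have hA : PolyBounded fun κ => BitCode.len (MatIn (k κ) (m κ) (N κ) b) := by
    cases b
    · exact hk.mul (hm.mul hN)
    · exact hm.mul (hm.mul hN)
  have hG : PolyBounded fun κ => BitCode.len (Matrix (Fin (k κ)) (Fin (m κ)) (ZMod (N κ))) :=
    hk.mul (hm.mul hN)
  refine ⟨τ, fun κ a r => ((I κ (Function.update (z κ) b a) r).2,
    (I κ (Function.update (z κ) b a) r).1 b), fun κ a r => (hI κ).length_eq _ _,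
    hcp.mono fun κ => (hI κ).coins_le, ⟨_, ((hA.add hcp).add hcp).add (hcp.add hG), fun κ => ?_⟩,
    fun D σ hσ hD x hx => ?_⟩
  · obtain ⟨r₀, hr₀⟩ := (coins (τ κ)).support_nonempty
    have : Nonempty (MatIn (k κ) (m κ) (N κ) b × {r // r ∈ (coins (τ κ)).support}) :=
      ⟨z κ b, r₀, hr₀⟩
    have h0 := ((hI κ).computes.reindex
      fun ω : MatIn (k κ) (m κ) (N κ) b × {r // r ∈ (coins (τ κ)).support} =>
        (Function.update (z κ) b ω.1, ω.2))
    simp only [Function.update_self] at h0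
    obtain ⟨F, hF1, -, hF2⟩ := h0.hasCircuit
      (n := BitCode.len (MatIn (k κ) (m κ) (N κ) b) + ((τ κ).map Nat.size).sum)
      (m := (matrixMul (k := k κ) (add κ) (mul κ) (l κ)).transcriptLen b +
        BitCode.len (Matrix (Fin (k κ)) (Fin (m κ)) (ZMod (N κ))))
      (fun ω => by simp [BitCode.length_enc, length_of_mem_coins ω.2.2])
      (fun ω => by simp [BitCode.length_enc, (hI κ).length_eq])
    refine ⟨F, hF1.mono ?_, fun a r hr => hF2 (a, ⟨r, hr⟩)⟩
    have h1 := (hI κ).coins_le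
    have h2 := (hI κ).transcriptLen_le
    simp only [hc]
    omega
  -- The size reached by all reductions: the given distinguisher, the hardwired input of party `b`,
  -- and the growth `c` of the hybrid argument.
  · have hlevel := (hA.add hσ).add hcp
    obtain ⟨ε, hε, hεb⟩ := exists_negligible_bound
      (P := fun κ (x : ∀ b, SharePair (N κ) b) => real (add κ) x b)
      (Q := fun κ x => ideal b (μ κ) (simAdd κ) x (sumOfShared x))
      (fun D s hs hD x => hadv D s hs hD x fun _ => Set.mem_univ _) hlevel
    obtain ⟨ε', hε', hεb'⟩ := exists_negligible_bound
      (P := fun κ (x : ∀ b, SharePair (N κ) b) => real (mul κ) x b)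
      (Q := fun κ x => ideal b (ν κ) (simMul κ) x (prodOfShared x))
      (fun D s hs hD x => hadv' D s hs hD x fun _ => Set.mem_univ _) hlevel
    refine Negligible.of_le_mul (hε.add hε') hcp (fun κ => abs_nonneg _) fun κ => ?_
    refine (hI κ).advantage_le ⟨add_nonneg (hεb κ).1 (hεb' κ).1, fun D' hD' y => ⟨?_, ?_⟩⟩
      (hD κ) (hx κ)
    · exact ((hεb κ).2 D' hD' y).trans (le_add_of_nonneg_right (hεb' κ).1)
    · exact ((hεb' κ).2 D' hD' y).trans (le_add_of_nonneg_left (hεb κ).1)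

end SparseMPC

end

theorem lemma1 (k m N : ℕ → ℕ) [∀ κ, NeZero (N κ)]
    (hk : SparseMPC.PolyBounded k) (hm : SparseMPC.PolyBounded m)
    (hN : SparseMPC.PolyBounded fun κ => (N κ).size)
    (l : ∀ κ, Finset (Fin (m κ) × Fin (m κ)))
    (add mul : ∀ κ, SparseMPC.Protocol (SparseMPC.SharePair (N κ)) (fun _ => ZMod (N κ)))
    (hadd : SparseMPC.SemiHonestSecure add (fun _ => Set.univ) (fun _ => SparseMPC.sumOfShared))
    (hmul : SparseMPC.SemiHonestSecure mul (fun _ => Set.univ) (fun _ => SparseMPC.prodOfShared)) :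
    SparseMPC.SemiHonestSecure
      (fun κ => SparseMPC.matrixMul (k := k κ) (add κ) (mul κ) (l κ))
      (fun κ => SparseMPC.supportedIn (l κ)) (fun _ => SparseMPC.matProd) :=
  SparseMPC.semiHonestSecure_matrixMul k m N hk hm hN l add mul hadd hmul
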